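/- Let $X$ be a compact smooth manifold of dimension $2n$ and let $J$ be an almost-complex structure on $X$, that is, a smooth section of $\mathrm{End}(TX)$ with $J^2=-\mathrm{id}$. View $J$ as the generalized-almost-complex structure $\mathcal{J}=\begin{pmatrix}-J&0\\0&J^*\end{pmatrix}\in\mathrm{End}(TX\oplus T^*X)$. Let $\wedge^\bullet X\otimes\mathbb{C}$ be the space of smooth complex differential forms (of mixed degree) and $GH_{dR}(X)=\ker d/\operatorname{im} d=\bigoplus_k H^k_{dR}(X;\mathbb{C})$ the total complex de Rham cohomology. For any generalized-almost-complex structure $\mathcal{J}$ (a smooth endomorphism of $TX\oplus T^*X$, orthogonal for $\langle X+\xi,Y+\eta\rangle=\frac12(\xi(Y)+\eta(X))$, with $\mathcal{J}^2=-\mathrm{id}$), let $L\subset(TX\oplus T^*X)\otimes\mathbb{C}$ be its $i$-eigenbundle, let $U\subset\wedge^\bullet X\otimes\mathbb{C}$ be the line bundle generated by the forms $\rho$ whose annihilator under the Clifford action $(X+\xi)\cdot\varphi=\iota_X\varphi+\xi\wedge\varphi$ is precisely $L$, and put $U^k=\wedge^{n-k}\bar L\cdot U$ for $k\in\mathbb{Z}$.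 Let $$GH^{(k)}_{\mathcal{J}}(X)=\{[\alpha]\in GH_{dR}(X): d\alpha=0,\ \alpha\in U^k\}.$$ $\mathcal{J}$ is called $\mathcal{C}^\infty$-pure-and-full if $GH_{dR}(X)=\bigoplus_{k\in\mathbb{Z}}GH^{(k)}_{\mathcal{J}}(X)$, that is, the sum of these subspaces is direct and is everything. For $(p,q)\in\mathbb{Z}^2$ let $H^{(p,q)}_J(X)=\{[\alpha]\in H^\bullet_{dR}(X;\mathbb{C}): d\alpha=0,\ \alpha\in\wedge^{p,q}_JX\}$. For $k\in\mathbb{Z}$, $J$ is called complex-$\mathcal{C}^\infty$-pure-and-full at the $k$th stage (in the sense of Li and Zhang) if $\bigoplus_{p+q=k}H^{(p,q)}_J(X)=H^k_{dR}(X;\mathbb{C})$ (again the sum is direct and is everything). Then: 1. For every $k\in\mathbb{Z}$, the sum of the subspaces $H^{(p,q)}_J(X)$ with $p-q=k$ is direct, and $GH^{(k)}_{\mathcal{J}}(X)=\bigoplus_{p-q=k}H^{(p,q)}_J(X)$. 2. $\mathcal{J}$ is $\mathcal{C}^\infty$-pure-and-full if and only if $J$ is complex-$\mathcal{C}^\infty$-pure-and-full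 at the $k$th stage for every $k\in\mathbb{Z}$. -/

import Mathlib

open scoped Manifold ContDiff TensorProduct

noncomputable section

namespace GenComplex

/-! ### Linear algebra on one (co)tangent space -/

section LinearAlgebra

variable {V : Type*} [AddCommGroup V] [Module ℝ V]

/-- The complexified exterior algebra `⨁ₖ ⋀ᵏ V* ⊗ ℂ`, a `k`-form being an alternating
`ℝ`-multilinear map to `ℂ`. For finite-dimensional `V` the components of degree `k > dim V`
vanish, so that the product over `k` is the direct sum. -/
abbrev ExtForms (V : Type*) [AddCommGroup V] [Module ℝ V] : Type _ :=
  (k : ℕ) → V [⋀^Fin k]→ₗ[ℝ] ℂ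

/-- Interior product `φ ↦ ι_v φ`, `(ι_v φ)(v₁, …, vₖ) = φ(v, v₁, …, vₖ)`. -/
def interior (v : V) : ExtForms V →ₗ[ℂ] ExtForms V where
  toFun φ k := (φ (k + 1)).curryLeft v
  map_add' _ _ := rfl
  map_smul' _ _ := rfl

/-- Exterior product `φ ↦ η ∧ φ` with a complex covector,
`(η ∧ φ)(v₀, …, vₖ) = ∑ᵢ (-1)ⁱ η(vᵢ) φ(v₀, …, v̂ᵢ, …, vₖ)`. -/
def wedge (η : V →ₗ[ℝ] ℂ) : ExtForms V →ₗ[ℂ] ExtForms V where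
  toFun φ
    | 0 => 0
    | k + 1 => AlternatingMap.alternatizeUncurryFin (η.smulRight (φ k))
  map_add' φ ψ := by
    funext k
    cases k with
    | zero => simp
    | succ k =>
      ext v
      simp [AlternatingMap.alternatizeUncurryFin_apply, Finset.sum_add_distrib]
  map_smul' c φ := by
    funext k
    cases k with
    | zero => simp
    | succ k =>
      ext v
      simp only [AlternatingMap.alternatizeUncurryFin_apply, LinearMap.smulRight_apply,
        Pi.smul_apply, AlternatingMap.smul_apply, smul_eq_mul, RingHom.id_apply, Finset.mul_sum,
        zsmul_eq_mul]
      refine Finset.sum_congr rfl fun i _ => ?_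
      ring

lemma interior_apply (v : V) (φ : ExtForms V) (k : ℕ) (w : Fin k → V) :
    interior v φ k w = φ (k + 1) (Matrix.vecCons v w) := rfl

lemma wedge_zero (η : V →ₗ[ℝ] ℂ) (φ : ExtForms V) : wedge η φ 0 = 0 := rfl

lemma wedge_succ (η : V →ₗ[ℝ] ℂ) (φ : ExtForms V) (k : ℕ) (w : Fin (k + 1) → V) :
    wedge η φ (k + 1) w = ∑ i : Fin (k + 1), (-1) ^ (i : ℕ) * (η (w i) * φ k (i.removeNth w)) := by
  simp [wedge, AlternatingMap.alternatizeUncurryFin_apply]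

/-- The constant `1 ∈ ⋀⁰ V* ⊗ ℂ`. -/
def unitForm : ExtForms V
  | 0 => AlternatingMap.constOfIsEmpty ℝ V (Fin 0) (1 : ℂ)
  | _ + 1 => 0

/-- `⋀^{p,q} V*` for an endomorphism `J` with `J² = -1`: the span of the products
`ξ₁ ∧ ⋯ ∧ ξ_p ∧ η₁ ∧ ⋯ ∧ η_q` with `ξᵢ` of type `(1,0)`, that is `ξᵢ ∘ J = i ξᵢ`, and `ηⱼ` of type
`(0,1)`, that is `ηⱼ ∘ J = -i ηⱼ`. It is zero if `p < 0` or `q < 0`. -/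
def typeForms (J : V →ₗ[ℝ] V) (p q : ℤ) : Submodule ℂ (ExtForms V) :=
  Submodule.span ℂ {φ | ∃ a b : List (V →ₗ[ℝ] ℂ),
    (a.length : ℤ) = p ∧ (b.length : ℤ) = q ∧
    (∀ ξ ∈ a, ∀ v, ξ (J v) = Complex.I * ξ v) ∧
    (∀ η ∈ b, ∀ v, η (J v) = -Complex.I * η v) ∧
    φ = (a ++ b).foldr (fun η ψ => wedge η ψ) unitForm}

variable [TopologicalSpace V]

/-- The natural pairing `⟨v + ξ, w + η⟩ = (ξ(w) + η(v)) / 2` on `V ⊕ V*`. -/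
def pairing (u w : V × (V →L[ℝ] ℝ)) : ℝ := (u.2 w.1 + w.2 u.1) / 2

/-- The real Clifford action `(v + ξ) · φ = ι_v φ + ξ ∧ φ`. -/
def cliffordAct : V × (V →L[ℝ] ℝ) →ₗ[ℝ] Module.End ℂ (ExtForms V) where
  toFun u := interior u.1 + wedge (Complex.ofRealCLM.toLinearMap ∘ₗ u.2.toLinearMap)
  map_add' u w := by
    refine LinearMap.ext fun φ => funext fun k => ?_
    ext v
    have h (j : ℕ) (v : Fin j → V) : φ (j + 1) (Matrix.vecCons (u.1 + w.1) v) =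
        φ (j + 1) (Matrix.vecCons u.1 v) + φ (j + 1) (Matrix.vecCons w.1 v) :=
      (φ (j + 1)).map_vecCons_add v u.1 w.1
    cases k with
    | zero => simp [interior_apply, wedge_zero, h]
    | succ k =>
      simp [interior_apply, wedge_succ, h, add_mul, mul_add, Finset.sum_add_distrib]
      ring
  map_smul' c u := by
    refine LinearMap.ext fun φ => funext fun k => ?_
    ext v
    have h (j : ℕ) (v : Fin j → V) : φ (j + 1) (Matrix.vecCons (c • u.1) v) =
        c • φ (j + 1) (Matrix.vecCons u.1 v) := (φ (j + 1)).map_vecCons_smul v c u.1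
    cases k with
    | zero => simp [interior_apply, wedge_zero, h]
    | succ k =>
      simp [interior_apply, wedge_succ, h, Finset.mul_sum]
      refine Finset.sum_congr rfl fun i _ => ?_
      ring

/-- The `ℂ`-bilinear extension of the Clifford action to `(V ⊕ V*) ⊗ ℂ`. -/
def cliffordActC : ℂ ⊗[ℝ] (V × (V →L[ℝ] ℝ)) →ₗ[ℂ] Module.End ℂ (ExtForms V) :=
  LinearMap.liftBaseChange ℂ cliffordAct

/-- Complex conjugation on `(V ⊕ V*) ⊗ ℂ`. -/
def conjC : ℂ ⊗[ℝ] (V × (V →L[ℝ] ℝ)) →ₗ[ℝ] ℂ ⊗[ℝ] (V × (V →L[ℝ] ℝ)) :=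
  LinearMap.rTensor _ Complex.conjAe.toLinearMap

/-- `L`: the `i`-eigenspace of the `ℂ`-linear extension of `𝒥` to `(V ⊕ V*) ⊗ ℂ`. -/
def eigenL (𝒥 : V × (V →L[ℝ] ℝ) →ₗ[ℝ] V × (V →L[ℝ] ℝ)) :
    Submodule ℂ (ℂ ⊗[ℝ] (V × (V →L[ℝ] ℝ))) :=
  Module.End.eigenspace (𝒥.baseChange ℂ) Complex.I

/-- `U`: generated by the forms `ρ` whose Clifford annihilator is precisely `L`. -/
def spinorLine (𝒥 : V × (V →L[ℝ] ℝ) →ₗ[ℝ] V × (V →L[ℝ] ℝ)) : Submodule ℂ (ExtForms V) :=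
  Submodule.span ℂ {ρ | ∀ w, cliffordActC w ρ = 0 ↔ w ∈ eigenL 𝒥}

/-- `Uᵏ = ⋀^{n-k} L̄ · U`: spanned by the `w₁ · (w₂ · (⋯ · ρ))` with `n - k` factors `wᵢ` in the
complex conjugate `L̄` of `L` and `ρ ∈ U`. (`L̄` is isotropic, so its exterior algebra is the
subalgebra of the Clifford algebra it generates.) It is zero for `k > n`. -/
def gradedU (𝒥 : V × (V →L[ℝ] ℝ) →ₗ[ℝ] V × (V →L[ℝ] ℝ)) (n : ℕ) (k : ℤ) :
    Submodule ℂ (ExtForms V) :=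
  Submodule.span ℂ {φ | ∃ (l : List (ℂ ⊗[ℝ] (V × (V →L[ℝ] ℝ)))) (ρ : ExtForms V),
    (l.length : ℤ) = n - k ∧ (∀ w ∈ l, conjC w ∈ eigenL 𝒥) ∧ ρ ∈ spinorLine 𝒥 ∧
    φ = l.foldr (fun w ψ => cliffordActC w ψ) ρ}

end LinearAlgebra

/-! ### Differential forms and de Rham cohomology of a `2n`-dimensional manifold -/

/-- The model space `ℝ²ⁿ`. -/
abbrev Model (n : ℕ) : Type := EuclideanSpace ℝ (Fin (2 * n))

section Forms

variable (n : ℕ) (X : Type*) [TopologicalSpace X] [ChartedSpace (Model n) X]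

/-- Complex-valued inhomogeneous differential forms, without any regularity. (The components of
degree `k > 2n` vanish.) -/
def RawForms : Type _ :=
  (k : ℕ) → (x : X) → TangentSpace (𝓡 (2 * n)) x [⋀^Fin k]→L[ℝ] ℂ

instance : AddCommGroup (RawForms n X) :=
  inferInstanceAs (AddCommGroup ((k : ℕ) → (x : X) → TangentSpace (𝓡 (2 * n)) x [⋀^Fin k]→L[ℝ] ℂ))

instance : Module ℂ (RawForms n X) :=
  inferInstanceAs (Module ℂ ((k : ℕ) → (x : X) → TangentSpace (𝓡 (2 * n)) x [⋀^Fin k]→L[ℝ] ℂ))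

variable {n X}

/-- The value of a form at a point. -/
def RawForms.at (α : RawForms n X) (x : X) : ExtForms (TangentSpace (𝓡 (2 * n)) x) :=
  fun k => (α k x).toAlternatingMap

/-- A `k`-form read in the chart at `x₀`: its pull-back under the inverse of the chart. -/
def inChart {k : ℕ} (τ : (x : X) → TangentSpace (𝓡 (2 * n)) x [⋀^Fin k]→L[ℝ] ℂ) (x₀ : X)
    (y : Model n) : Model n [⋀^Fin k]→L[ℝ] ℂ :=
  (τ ((extChartAt (𝓡 (2 * n)) x₀).symm y)).compContinuousLinearMap
    (mfderiv 𝓘(ℝ, Model n) (𝓡 (2 * n)) (extChartAt (𝓡 (2 * n)) x₀).symm y)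

/-- The form is smooth: its coefficients in every chart are. -/
def IsSmooth (α : RawForms n X) : Prop :=
  ∀ (k : ℕ) (x₀ : X), ContDiffOn ℝ ∞ (inChart (α k) x₀) (extChartAt (𝓡 (2 * n)) x₀).target

/-- The exterior derivative. At the point `x`, the exterior derivative in `ℝ²ⁿ` is applied to the
form read in the chart at `x`, and the result is pulled back to `X` by that chart. -/
def extD (α : RawForms n X) : RawForms n X
  | 0, _ => 0
  | k + 1, x => (extDeriv (inChart (α k) x) (extChartAt (𝓡 (2 * n)) x x)).compContinuousLinearMap
      (mfderiv (𝓡 (2 * n)) 𝓘(ℝ, Model n) (extChartAt (𝓡 (2 * n)) x) x)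

lemma inChart_zero (k : ℕ) (x₀ : X) : inChart ((0 : RawForms n X) k) x₀ = 0 := rfl

lemma inChart_add (α β : RawForms n X) (k : ℕ) (x₀ : X) :
    inChart ((α + β) k) x₀ = inChart (α k) x₀ + inChart (β k) x₀ := rfl

lemma inChart_smul (c : ℂ) (α : RawForms n X) (k : ℕ) (x₀ : X) :
    inChart ((c • α) k) x₀ = c • inChart (α k) x₀ := rfl

lemma IsSmooth.differentiableAt {α : RawForms n X} (h : IsSmooth α) (k : ℕ) (x : X) :
    DifferentiableAt ℝ (inChart (α k) x) (extChartAt (𝓡 (2 * n)) x x) :=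
  ((h k x).contDiffAt (extChartAt_target_mem_nhds x)).differentiableAt (by simp)

lemma extD_add {α β : RawForms n X} (hα : IsSmooth α) (hβ : IsSmooth β) :
    extD (α + β) = extD α + extD β := by
  funext k x
  cases k with
  | zero => exact (add_zero (0 : TangentSpace (𝓡 (2 * n)) x [⋀^Fin 0]→L[ℝ] ℂ)).symm
  | succ k =>
    simp only [extD, inChart_add]
    rw [extDeriv_add (hα.differentiableAt k x) (hβ.differentiableAt k x)]
    rfl

lemma extD_smul (c : ℂ) {α : RawForms n X} (hα : IsSmooth α) :
    extD (c • α) = c • extD α := by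
  funext k x
  cases k with
  | zero => exact (smul_zero (A := TangentSpace (𝓡 (2 * n)) x [⋀^Fin 0]→L[ℝ] ℂ) c).symm
  | succ k =>
    have h : extDeriv (c • inChart (α k) x) (extChartAt (𝓡 (2 * n)) x x) =
        c • extDeriv (inChart (α k) x) (extChartAt (𝓡 (2 * n)) x x) := by
      ext v
      simp only [extDeriv, fderiv_const_smul (hα.differentiableAt k x),
        ContinuousAlternatingMap.smul_apply,
        ContinuousAlternatingMap.alternatizeUncurryFin_apply, Finset.smul_sum]
      refine Finset.sum_congr rfl fun i _ => ?_
      exact (smul_comm c ((-1 : ℤ) ^ (i : ℕ)) _).symm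
    simp only [extD, inChart_smul, h]
    rfl

variable (n X)

/-- The space `⋀• X ⊗ ℂ` of smooth complex differential forms. -/
def smoothForms : Submodule ℂ (RawForms n X) where
  carrier := {α | IsSmooth α}
  zero_mem' k x₀ := by
    rw [inChart_zero]
    exact contDiffOn_const
  add_mem' {α β} hα hβ k x₀ := by
    rw [inChart_add]
    exact (hα k x₀).add (hβ k x₀)
  smul_mem' c α hα k x₀ := by
    rw [inChart_smul]
    exact contDiffOn_const.smul (hα k x₀)

/-- The space `ker d` of closed smooth forms. -/
def closedForms : Submodule ℂ (RawForms n X) where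
  carrier := {α | IsSmooth α ∧ extD α = 0}
  zero_mem' := by
    refine ⟨(smoothForms n X).zero_mem, ?_⟩
    simpa using extD_smul (0 : ℂ) (smoothForms n X).zero_mem
  add_mem' {α β} hα hβ :=
    ⟨(smoothForms n X).add_mem hα.1 hβ.1, by simp [extD_add hα.1 hβ.1, hα.2, hβ.2]⟩
  smul_mem' c α hα :=
    ⟨(smoothForms n X).smul_mem c hα.1, by simp [extD_smul c hα.1, hα.2]⟩

/-- The space `im d` of exact forms `d β`, `β` smooth, inside the closed ones. -/
def exactForms : Submodule ℂ (closedForms n X) where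
  carrier := {α | ∃ β : RawForms n X, IsSmooth β ∧ extD β = α}
  zero_mem' := ⟨0, (smoothForms n X).zero_mem, ((closedForms n X).zero_mem).2⟩
  add_mem' := by
    rintro α α' ⟨β, hβ, h⟩ ⟨β', hβ', h'⟩
    exact ⟨β + β', (smoothForms n X).add_mem hβ hβ', by simp [extD_add hβ hβ', h, h']⟩
  smul_mem' := by
    rintro c α ⟨β, hβ, h⟩
    exact ⟨c • β, (smoothForms n X).smul_mem c hβ, by simp [extD_smul c hβ, h]⟩

/-- The total complex de Rham cohomology `H•_dR(X; ℂ) = ker d / im d`. -/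
abbrev DeRham : Type _ := closedForms n X ⧸ exactForms n X

variable {n X}

/-- The subspace of those de Rham classes that have a closed representative in `S`. -/
def classesOf (S : Submodule ℂ (RawForms n X)) : Submodule ℂ (DeRham n X) :=
  (S.comap (closedForms n X).subtype).map (exactForms n X).mkQ

/-- The forms whose value at every point `x` lies in a given subspace `S x`: the sections of
a sub-bundle of the bundle of forms. -/
def sectionsOf (S : (x : X) → Submodule ℂ (ExtForms (TangentSpace (𝓡 (2 * n)) x))) :
    Submodule ℂ (RawForms n X) where
  carrier := {α | ∀ x, α.at x ∈ S x}
  zero_mem' x := (S x).zero_mem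
  add_mem' hα hβ x := (S x).add_mem (hα x) (hβ x)
  smul_mem' c _ hα x := (S x).smul_mem c (hα x)

variable (n X)

/-- The forms that are homogeneous of degree `k` (only `0` if `k < 0`). -/
def homogeneousForms (k : ℤ) : Submodule ℂ (RawForms n X) where
  carrier := {α | ∀ j : ℕ, (j : ℤ) ≠ k → α j = 0}
  zero_mem' _ _ := rfl
  add_mem' {α β} hα hβ j hj := by
    change α j + β j = 0
    rw [hα j hj, hβ j hj, add_zero]
  smul_mem' c α hα j hj := by
    funext x
    change c • α j x = 0
    rw [hα j hj]
    exact smul_zero (A := TangentSpace (𝓡 (2 * n)) x [⋀^Fin j]→L[ℝ] ℂ) c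

/-- `Hᵏ_dR(X; ℂ)`, as a subspace of the total cohomology. -/
def deRhamDeg (k : ℤ) : Submodule ℂ (DeRham n X) := classesOf (homogeneousForms n X k)

end Forms

/-! ### (Generalized-)almost-complex structures -/

section Structures

variable (n : ℕ) (X : Type*) [TopologicalSpace X] [ChartedSpace (Model n) X]


/-- The fibre of `TX ⊕ T*X`. -/
abbrev GenTangent {n : ℕ} {X : Type*} [TopologicalSpace X] [ChartedSpace (Model n) X] (x : X) :
    Type :=
  TangentSpace (𝓡 (2 * n)) x × (TangentSpace (𝓡 (2 * n)) x →L[ℝ] Bundle.Trivial X ℝ x)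

/-- The model fibre of `TX ⊕ T*X`. -/
abbrev GenModel (n : ℕ) : Type := Model n × (Model n →L[ℝ] ℝ)

variable [IsManifold (𝓡 (2 * n)) ∞ X]

/-- An almost-complex structure: a smooth section `J` of `End(TX)` with `J² = -1`. -/
structure AlmostComplex where
  toFun : (x : X) → TangentSpace (𝓡 (2 * n)) x →L[ℝ] TangentSpace (𝓡 (2 * n)) x
  smooth : ContMDiff (𝓡 (2 * n)) ((𝓡 (2 * n)).prod 𝓘(ℝ, Model n →L[ℝ] Model n)) ∞
    (fun x => Bundle.TotalSpace.mk' (Model n →L[ℝ] Model n)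
      (E := fun x : X => TangentSpace (𝓡 (2 * n)) x →L[ℝ] TangentSpace (𝓡 (2 * n)) x) x (toFun x))
  sq : ∀ x v, toFun x (toFun x v) = -v

/-- A generalized-almost-complex structure: a smooth section `𝒥` of `End(TX ⊕ T*X)`, orthogonal for
the natural pairing, with `𝒥² = -1`. -/
structure GenAlmostComplex where
  toFun : (x : X) → GenTangent (n := n) x →L[ℝ] GenTangent (n := n) x
  smooth : ContMDiff (𝓡 (2 * n)) ((𝓡 (2 * n)).prod 𝓘(ℝ, GenModel n →L[ℝ] GenModel n)) ∞
    (fun x => Bundle.TotalSpace.mk' (GenModel n →L[ℝ] GenModel n)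
      (E := fun x : X => GenTangent (n := n) x →L[ℝ] GenTangent (n := n) x) x (toFun x))
  orthogonal : ∀ x u w, pairing (V := TangentSpace (𝓡 (2 * n)) x) (toFun x u) (toFun x w) =
    pairing (V := TangentSpace (𝓡 (2 * n)) x) u w
  sq : ∀ x u, toFun x (toFun x u) = -u

variable {n X}

/-- `v + ξ ↦ -A v + A* ξ` where `A* ξ = ξ ∘ A`. -/
def blockMap {V : Type*} [AddCommGroup V] [Module ℝ V] [TopologicalSpace V]
    [IsTopologicalAddGroup V]
    (A : V →L[ℝ] V) : V × (V →L[ℝ] ℝ) →L[ℝ] V × (V →L[ℝ] ℝ) :=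
  (-A).prodMap (ContinuousLinearMap.precomp ℝ A)

lemma smooth_blockMap (J : AlmostComplex n X) : 
   ContMDiff (𝓡 (2 * n)) ((𝓡 (2 * n)).prod 𝓘(ℝ, GenModel n →L[ℝ] GenModel n)) ∞
    (fun x => Bundle.TotalSpace.mk' (GenModel n →L[ℝ] GenModel n)
      (E := fun x : X => GenTangent (n := n) x →L[ℝ] GenTangent (n := n) x) x (blockMap (J.toFun x))) := by
  intro x₀
  have h := (contMDiffAt_hom_bundle _).1 (J.smooth x₀)
  rw [contMDiffAt_hom_bundle]
  refine ⟨h.1, ?_⟩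
  have h2 := h.2.neg.clm_prodMap (h.2.clm_precomp (F₃ := ℝ))
  refine h2.congr_of_eventuallyEq ?_
  have hx : (trivializationAt (Model n) (TangentSpace (𝓡 (2 * n))) x₀).baseSet ∈ nhds x₀ :=
    (trivializationAt (Model n) (TangentSpace (𝓡 (2 * n)) (M := X)) x₀).open_baseSet.mem_nhds
      (FiberBundle.mem_baseSet_trivializationAt' x₀)
  filter_upwards [hx] with x hx
  let e := trivializationAt (Model n) (TangentSpace (𝓡 (2 * n)) (M := X)) x₀
  let e' := trivializationAt (GenModel n) (fun x : X => GenTangent (n := n) x) x₀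
  have hx' : x ∈ e'.baseSet := ⟨hx, hx, Set.mem_univ x⟩
  have key (u : GenTangent (n := n) x) : e'.continuousLinearMapAt ℝ x u =
      (e.continuousLinearMapAt ℝ x u.1, u.2.comp (e.symmL ℝ x)) := by
    rw [Bundle.Trivialization.continuousLinearMapAt_apply,
      Bundle.Trivialization.coe_linearMapAt_of_mem _ hx',
      Bundle.Trivialization.continuousLinearMapAt_apply,
      Bundle.Trivialization.coe_linearMapAt_of_mem _ hx]
    refine Prod.ext rfl (ContinuousLinearMap.ext fun v => ?_)
    change (Bundle.Trivial.trivialization X ℝ).continuousLinearMapAt ℝ x (u.2 (e.symmL ℝ x v)) = _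
    rw [Bundle.Trivial.continuousLinearMapAt_trivialization]
    rfl
  refine ContinuousLinearMap.ext fun w => ?_
  obtain ⟨u, rfl⟩ : ∃ u, w = e'.continuousLinearMapAt ℝ x u :=
    ⟨e'.symmL ℝ x w, (e'.continuousLinearMapAt_symmL hx' w).symm⟩
  change e'.continuousLinearMapAt ℝ x (blockMap (J.toFun x) (e'.symmL ℝ x
    (e'.continuousLinearMapAt ℝ x u))) = _
  rw [e'.symmL_continuousLinearMapAt hx', key, key]
  refine Prod.ext ?_ ?_
  · change e.continuousLinearMapAt ℝ x (-(J.toFun x u.1)) = -(e.continuousLinearMapAt ℝ x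
      (J.toFun x (e.symmL ℝ x (e.continuousLinearMapAt ℝ x u.1))))
    rw [e.symmL_continuousLinearMapAt hx, map_neg]
  · ext v
    change u.2 (J.toFun x (e.symmL ℝ x v)) = u.2 (e.symmL ℝ x (e.continuousLinearMapAt ℝ x
      (J.toFun x (e.symmL ℝ x v))))
    rw [e.symmL_continuousLinearMapAt hx]

/-- The generalized-almost-complex structure `𝒥_J = (-J, 0; 0, J*)` of an almost-complex
structure `J`. -/
def AlmostComplex.toGen (J : AlmostComplex n X) : GenAlmostComplex n X where
  toFun x := blockMap (J.toFun x)
  smooth := smooth_blockMap J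
  orthogonal x u w := by
    change (u.2 (J.toFun x (-(J.toFun x w.1))) + w.2 (J.toFun x (-(J.toFun x u.1)))) / 2 =
      (u.2 w.1 + w.2 u.1) / 2
    simp [J.sq]
  sq x u := by
    refine Prod.ext ?_ ?_
    · change -(J.toFun x (-(J.toFun x u.1))) = -u.1
      simp [J.sq]
    · ext v
      change u.2 (J.toFun x (J.toFun x v)) = -(u.2 v)
      simp [J.sq]

/-- The space of (not necessarily smooth) sections of `Uᵏ`. -/
def GenAlmostComplex.formsU (𝒥 : GenAlmostComplex n X) (k : ℤ) : Submodule ℂ (RawForms n X) :=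
  sectionsOf fun x => gradedU (V := TangentSpace (𝓡 (2 * n)) x) (𝒥.toFun x).toLinearMap n k

/-- `GH^{(k)}_𝒥(X) = (ker d ∩ Uᵏ) / im d`, a subspace of `GH_dR(X) = ker d / im d`. -/
def GenAlmostComplex.GH (𝒥 : GenAlmostComplex n X) (k : ℤ) : Submodule ℂ (DeRham n X) :=
  classesOf (𝒥.formsU k)

/-- `𝒥` is `C^∞`-pure: the sum of the `GH^{(k)}_𝒥(X)`, `k ∈ ℤ`, is direct. -/
def GenAlmostComplex.IsPure (𝒥 : GenAlmostComplex n X) : Prop := iSupIndep 𝒥.GH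

/-- `𝒥` is `C^∞`-full: the sum of the `GH^{(k)}_𝒥(X)`, `k ∈ ℤ`, is `GH_dR(X)`. -/
def GenAlmostComplex.IsFull (𝒥 : GenAlmostComplex n X) : Prop := ⨆ k, 𝒥.GH k = ⊤

/-- `𝒥` is `C^∞`-pure-and-full. -/
def GenAlmostComplex.IsPureAndFull (𝒥 : GenAlmostComplex n X) : Prop := 𝒥.IsPure ∧ 𝒥.IsFull

/-- `H^{(p,q)}_J(X)`: the classes of closed forms of type `(p,q)`. -/
def AlmostComplex.H (J : AlmostComplex n X) (p q : ℤ) : Submodule ℂ (DeRham n X) :=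
  classesOf (sectionsOf fun x => typeForms (J.toFun x).toLinearMap p q)

/-- `J` is complex-`C^∞`-pure-and-full at the `k`th stage: `⨁_{p+q=k} H^{(p,q)}_J = Hᵏ_dR(X; ℂ)`. -/
def AlmostComplex.IsPureAndFullAt (J : AlmostComplex n X) (k : ℤ) : Prop :=
  iSupIndep (fun a : {a : ℤ × ℤ // a.1 + a.2 = k} => J.H a.1.1 a.1.2) ∧
    ⨆ a : {a : ℤ × ℤ // a.1 + a.2 = k}, J.H a.1.1 a.1.2 = deRhamDeg n X k

end Structures

end GenComplex

end

noncomputable section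

namespace GenComplex

section LinearAlgebra

open Complex (I)

variable {V : Type*} [AddCommGroup V] [Module ℝ V]

/-! ### Interior and exterior products -/

/-! The heart is pointwise linear algebra. For the block structure `-J ⊕ J*` the `i`-eigenspace is
`L = T^{0,1} ⊕ (T*)^{1,0}`, so the forms with annihilator `L` are the nonzero forms of type `(n,0)`
(`spinorLine_eq`). The conjugate `L̄ = T^{1,0} ⊕ (T*)^{0,1}` acts by contractions, which lower `p`
by one, and by exterior products, which raise `q` by one; both lower `p - q` by one. Hence `U^k`
lies in the sum of the `⋀^{p,q}` with `p - q = k` (`gradedU_le`). Conversely every `⋀^{p,q}` is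
reached from `⋀^{n,0}`: wedge with `(0,1)`-covectors to get `⋀^{n,q}`, then descend in `p` by the
identity `2(n - p) φ = ∑ⱼ ι_{eⱼ - iJeⱼ}(ξⱼ ∧ φ)` (`typeForms_le_gradedU`).

Nothing is assumed about integrability, so the type components of a closed form need not be closed.
Its degree components are, because `d` is homogeneous. Inside `U^k` this is enough: the degree `d`
and the difference `p - q = k` determine `(p,q)`, so each degree component is of a single type. This
gives `GH^{(k)} = ∑_{p-q=k} H^{(p,q)}` (`GH_toGen`). The sum is direct since its terms lie in the
spaces `H^{p+q}_dR` of distinct degrees.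

For the second claim, both properties say that the whole family `H^{(p,q)}` is independent with sum
the total cohomology. Group the pairs by `p - q` or by `p + q` (`iSupIndep_iff_fibers`). In the
first grouping independence inside a fibre is automatic; in the second, independence of the fibre
sums is, since they lie in the independent spaces `H^k_dR`. Fullness in total forces equality in
each degree for the same reason. -/

lemma interior_add (v w : V) (φ : ExtForms V) :
    interior (v + w) φ = interior v φ + interior w φ := by
  funext k
  ext x
  exact (φ (k + 1)).map_vecCons_add x v w

lemma interior_smul (c : ℝ) (v : V) (φ : ExtForms V) :
    interior (c • v) φ = (c : ℂ) • interior v φ := by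
  funext k
  ext x
  have h := (φ (k + 1)).map_vecCons_smul x c v
  simpa [interior_apply] using h

lemma interior_neg (v : V) (φ : ExtForms V) : interior (-v) φ = -interior v φ := by
  simpa using interior_smul (-1) v φ

lemma interior_sum {ι : Type*} (s : Finset ι) (v : ι → V) (φ : ExtForms V) :
    interior (∑ i ∈ s, v i) φ = ∑ i ∈ s, interior (v i) φ := by
  classical
  induction s using Finset.induction_on with
  | empty => simpa using interior_smul 0 (0 : V) φ
  | insert a s ha ih => rw [Finset.sum_insert ha, Finset.sum_insert ha, interior_add, ih]

lemma interior_self (v : V) (φ : ExtForms V) : interior v (interior v φ) = 0 := by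
  funext k
  ext x
  exact (φ (k + 1 + 1)).map_eq_zero_of_eq (Matrix.vecCons v (Matrix.vecCons v x))
    (i := 0) (j := 1) (by simp) (by simp)

/-- Polarisation of `interior_self`. -/
lemma interior_interior (v w : V) (φ : ExtForms V) :
    interior v (interior w φ) = -interior w (interior v φ) := by
  have h := interior_self (v + w) φ
  simp only [interior_add, map_add, interior_self, zero_add, add_zero] at h
  exact eq_neg_of_add_eq_zero_right h

lemma wedge_add_left (η θ : V →ₗ[ℝ] ℂ) (φ : ExtForms V) :
    wedge (η + θ) φ = wedge η φ + wedge θ φ := by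
  funext k
  cases k with
  | zero => simp [wedge_zero]
  | succ k => ext w; simp [wedge_succ, add_mul, mul_add, Finset.sum_add_distrib]

lemma wedge_smul_left (c : ℂ) (η : V →ₗ[ℝ] ℂ) (φ : ExtForms V) :
    wedge (c • η) φ = c • wedge η φ := by
  funext k
  cases k with
  | zero => simp [wedge_zero]
  | succ k =>
    ext w
    simp only [wedge_succ, LinearMap.smul_apply, Pi.smul_apply, AlternatingMap.smul_apply,
      smul_eq_mul, Finset.mul_sum]
    exact Finset.sum_congr rfl fun i _ => by ring

lemma wedge_sum_left {ι : Type*} (s : Finset ι) (η : ι → V →ₗ[ℝ] ℂ) (φ : ExtForms V) :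
    wedge (∑ i ∈ s, η i) φ = ∑ i ∈ s, wedge (η i) φ := by
  classical
  induction s using Finset.induction_on with
  | empty => simpa using wedge_smul_left 0 (0 : V →ₗ[ℝ] ℂ) φ
  | insert a s ha ih => rw [Finset.sum_insert ha, Finset.sum_insert ha, wedge_add_left, ih]

/-- The interior product is an antiderivation. -/
lemma interior_wedge (v : V) (η : V →ₗ[ℝ] ℂ) (φ : ExtForms V) :
    interior v (wedge η φ) = η v • φ - wedge η (interior v φ) := by
  funext k
  ext w
  rw [interior_apply, wedge_succ, Fin.sum_univ_succ]
  have h0 : Fin.removeNth (0 : Fin (k + 1)) (Matrix.vecCons v w) = w := by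
    funext i; simp [Fin.removeNth]
  cases k with
  | zero =>
    simp [wedge_zero, h0]
  | succ k =>
    have hs (i : Fin (k + 1)) : Fin.removeNth i.succ (Matrix.vecCons v w) =
        Matrix.vecCons v (i.removeNth w) := by
      funext j
      refine Fin.cases ?_ (fun j => ?_) j
      · simp [Fin.removeNth]
      · simp [Fin.removeNth]
    have hr : (η v • φ - wedge η (interior v φ)) (k + 1) w =
        η v * φ (k + 1) w - wedge η (interior v φ) (k + 1) w := rfl
    rw [hr, wedge_succ]
    simp [hs, h0, interior_apply, pow_succ, sub_eq_add_neg]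

/-- Induction on the degree: a form of positive degree is determined by its contractions, and
`interior_wedge` reduces the contracted identity to the same one for `interior v φ`, one degree
lower. -/
lemma wedge_wedge (η θ : V →ₗ[ℝ] ℂ) (φ : ExtForms V) :
    wedge η (wedge θ φ) = -wedge θ (wedge η φ) := by
  suffices H : ∀ (k : ℕ) (φ : ExtForms V),
      wedge η (wedge θ φ) k = (-wedge θ (wedge η φ)) k from funext fun k => H k φ
  intro k
  induction k with
  | zero => intro φ; simp [wedge_zero]
  | succ k ih =>
    intro φ
    ext w
    have key (v : V) : interior v (wedge η (wedge θ φ)) k =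
        interior v (-wedge θ (wedge η φ)) k := by
      have := ih (interior v φ)
      simp only [map_neg, interior_wedge, map_sub, map_smul, Pi.sub_apply, Pi.neg_apply, this]
      abel
    have := congrArg (fun χ => χ (Matrix.vecTail w)) (key (Matrix.vecHead w))
    simpa only [interior_apply, Matrix.cons_head_tail] using this

lemma interior_unitForm (v : V) : interior v (unitForm : ExtForms V) = 0 := rfl

/-! ### Homogeneous components -/

/-- The component of degree `d` of an inhomogeneous form, as an inhomogeneous form. -/
def component (d : ℕ) : ExtForms V →ₗ[ℂ] ExtForms V :=
  LinearMap.single ℂ (fun k => V [⋀^Fin k]→ₗ[ℝ] ℂ) d ∘ₗ LinearMap.proj d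

lemma component_same (d : ℕ) (φ : ExtForms V) : component d φ d = φ d := by
  simp [component]

lemma component_of_ne {d k : ℕ} (h : k ≠ d) (φ : ExtForms V) : component d φ k = 0 := by
  simp [component, h]

lemma interior_component (v : V) (d : ℕ) (φ : ExtForms V) :
    interior v (component (d + 1) φ) = component d (interior v φ) := by
  funext k
  ext w
  rcases eq_or_ne k d with rfl | h
  · simp [interior_apply, component_same]
  · rw [interior_apply, component_of_ne h, component_of_ne (by omega)]; rfl

lemma interior_component_zero (v : V) (φ : ExtForms V) :
    interior v (component 0 φ) = 0 := by
  funext k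
  ext w
  rw [interior_apply, component_of_ne (by omega)]; rfl

lemma wedge_component (η : V →ₗ[ℝ] ℂ) (d : ℕ) (φ : ExtForms V) :
    wedge η (component d φ) = component (d + 1) (wedge η φ) := by
  funext k
  cases k with
  | zero => rw [component_of_ne (by omega)]; rfl
  | succ k =>
    ext w
    rcases eq_or_ne k d with rfl | h
    · simp [wedge_succ, component_same]
    · rw [wedge_succ, component_of_ne h, component_of_ne (by omega)]; simp

/-- The inhomogeneous forms concentrated in degree `d`. -/
def degreeForms (V : Type*) [AddCommGroup V] [Module ℝ V] (d : ℕ) : Submodule ℂ (ExtForms V) where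
  carrier := {φ | ∀ k, k ≠ d → φ k = 0}
  zero_mem' _ _ := rfl
  add_mem' {φ ψ} hφ hψ k hk := by simp [hφ k hk, hψ k hk]
  smul_mem' c φ hφ k hk := by simp [hφ k hk]

lemma component_of_mem {d : ℕ} {φ : ExtForms V} (h : φ ∈ degreeForms V d) :
    component d φ = φ := by
  funext k
  rcases eq_or_ne k d with rfl | hk
  · exact component_same _ _
  · rw [component_of_ne hk, h k hk]

lemma component_of_mem_of_ne {d e : ℕ} {φ : ExtForms V} (h : φ ∈ degreeForms V d) (hne : e ≠ d) :
    component e φ = 0 := by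
  funext k
  rcases eq_or_ne k e with rfl | hk
  · rw [component_same, h k hne]; rfl
  · rw [component_of_ne hk]; rfl

lemma component_mem (d : ℕ) (φ : ExtForms V) : component d φ ∈ degreeForms V d :=
  fun _ hk => component_of_ne hk φ

lemma wedge_mem_degreeForms (η : V →ₗ[ℝ] ℂ) {d : ℕ} {φ : ExtForms V}
    (h : φ ∈ degreeForms V d) : wedge η φ ∈ degreeForms V (d + 1) := by
  rw [← component_of_mem h, wedge_component]
  exact component_mem _ _

lemma interior_mem_degreeForms (v : V) {d : ℕ} {φ : ExtForms V}
    (h : φ ∈ degreeForms V (d + 1)) : interior v φ ∈ degreeForms V d := by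
  rw [← component_of_mem h, interior_component]
  exact component_mem _ _

lemma unitForm_mem_degreeForms : (unitForm : ExtForms V) ∈ degreeForms V 0 := by
  intro k hk
  obtain ⟨k, rfl⟩ := Nat.exists_eq_succ_of_ne_zero hk
  rfl

lemma eq_smul_unitForm {φ : ExtForms V} (h : φ ∈ degreeForms V 0) :
    φ = (φ 0 ![]) • unitForm := by
  funext k
  cases k with
  | zero =>
    ext w
    have : w = ![] := Subsingleton.elim _ _
    subst this
    change _ = φ 0 ![] * 1
    rw [mul_one]
  | succ k => rw [h _ (by omega)]; exact (smul_zero (A := V [⋀^Fin (k + 1)]→ₗ[ℝ] ℂ) (φ 0 ![])).symm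

lemma alternatingMap_eq_zero [FiniteDimensional ℝ V] {k : ℕ} (h : Module.finrank ℝ V < k)
    (f : V [⋀^Fin k]→ₗ[ℝ] ℂ) : f = 0 := by
  ext w
  refine f.map_linearDependent w fun hw => ?_
  have := hw.fintype_card_le_finrank
  simp at this
  omega

lemma eq_zero_of_mem_degreeForms [FiniteDimensional ℝ V] {d : ℕ} (h : Module.finrank ℝ V < d)
    {φ : ExtForms V} (hφ : φ ∈ degreeForms V d) : φ = 0 := by
  funext k
  rcases eq_or_ne k d with rfl | hk
  · exact alternatingMap_eq_zero h _
  · exact hφ k hk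

/-! ### Forms of type `(p, q)` -/

/-- The iterated exterior product of a list of covectors. -/
abbrev wedgeList (l : List (V →ₗ[ℝ] ℂ)) : ExtForms V :=
  l.foldr (fun η ψ => wedge η ψ) unitForm

lemma wedgeList_mem_degreeForms (l : List (V →ₗ[ℝ] ℂ)) :
    wedgeList l ∈ degreeForms V l.length := by
  induction l with
  | nil => exact unitForm_mem_degreeForms
  | cons η l ih => exact wedge_mem_degreeForms η ih

/-- Needed because the generators of `typeForms` list all `(1,0)`-covectors first: a new
`(0,1)`-covector must be carried past them, at the cost of a sign. -/
lemma wedgeList_append_cons (a b : List (V →ₗ[ℝ] ℂ)) (η : V →ₗ[ℝ] ℂ) :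
    wedgeList (a ++ η :: b) = (-1 : ℂ) ^ a.length • wedge η (wedgeList (a ++ b)) := by
  induction a with
  | nil => simp
  | cons ξ a ih =>
    change wedge ξ (wedgeList (a ++ η :: b)) = _ • wedge η (wedge ξ (wedgeList (a ++ b)))
    rw [ih, map_smul, wedge_wedge, List.length_cons, pow_succ]
    simp

variable {J : V →ₗ[ℝ] V}

lemma wedgeList_mem_typeForms {a b : List (V →ₗ[ℝ] ℂ)}
    (ha : ∀ ξ ∈ a, ∀ v, ξ (J v) = I * ξ v) (hb : ∀ η ∈ b, ∀ v, η (J v) = -I * η v) :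
    wedgeList (a ++ b) ∈ typeForms J a.length b.length :=
  Submodule.subset_span ⟨a, b, rfl, rfl, ha, hb, rfl⟩

lemma typeForms_le_iff {p q : ℕ} {S : Submodule ℂ (ExtForms V)} :
    typeForms J p q ≤ S ↔ ∀ a b : List (V →ₗ[ℝ] ℂ), a.length = p → b.length = q →
      (∀ ξ ∈ a, ∀ v, ξ (J v) = I * ξ v) → (∀ η ∈ b, ∀ v, η (J v) = -I * η v) →
      wedgeList (a ++ b) ∈ S := by
  refine Submodule.span_le.trans ⟨?_, ?_⟩
  · rintro h a b rfl rfl ha hb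
    exact h ⟨a, b, rfl, rfl, ha, hb, rfl⟩
  · rintro h _ ⟨a, b, hp, hq, ha, hb, rfl⟩
    exact h a b (by exact_mod_cast hp) (by exact_mod_cast hq) ha hb

lemma typeForms_eq_bot {p q : ℤ} (h : p < 0 ∨ q < 0) : typeForms J p q = ⊥ := by
  rw [eq_bot_iff]
  refine Submodule.span_le.2 ?_
  rintro _ ⟨a, b, hp, hq, -⟩
  omega

lemma typeForms_le_degreeForms (p q : ℕ) : typeForms J p q ≤ degreeForms V (p + q) := by
  rw [typeForms_le_iff]
  rintro a b rfl rfl - -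
  simpa using wedgeList_mem_degreeForms (a ++ b)

lemma wedge_mem_typeForms_left {ξ : V →ₗ[ℝ] ℂ} (hξ : ∀ v, ξ (J v) = I * ξ v) {p q : ℕ}
    {φ : ExtForms V} (hφ : φ ∈ typeForms J p q) : wedge ξ φ ∈ typeForms J (p + 1 : ℕ) q := by
  suffices typeForms J p q ≤ (typeForms J (p + 1 : ℕ) q).comap (wedge ξ) from this hφ
  rw [typeForms_le_iff]
  rintro a b rfl rfl ha hb
  exact wedgeList_mem_typeForms (a := ξ :: a) (by simpa using ⟨hξ, ha⟩) hb

lemma wedge_mem_typeForms_right {η : V →ₗ[ℝ] ℂ} (hη : ∀ v, η (J v) = -I * η v) {p q : ℕ}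
    {φ : ExtForms V} (hφ : φ ∈ typeForms J p q) : wedge η φ ∈ typeForms J p (q + 1 : ℕ) := by
  suffices typeForms J p q ≤ (typeForms J p (q + 1 : ℕ)).comap (wedge η) from this hφ
  rw [typeForms_le_iff]
  rintro a b rfl rfl ha hb
  have h := wedgeList_mem_typeForms (b := η :: b) ha (List.forall_mem_cons.2 ⟨hη, hb⟩)
  rw [wedgeList_append_cons] at h
  exact (Submodule.smul_mem_iff (typeForms J _ _) (pow_ne_zero _ (neg_ne_zero.2 one_ne_zero))).1 h

/-! ### Contraction with vectors of type `(1, 0)` and `(0, 1)` -/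

/-- Contraction with `v - i J v`, of type `(1, 0)`. -/
def contractHol (J : V →ₗ[ℝ] V) (v : V) : ExtForms V →ₗ[ℂ] ExtForms V :=
  interior v - I • interior (J v)

/-- Contraction with `v + i J v`, of type `(0, 1)`. -/
def contractAnti (J : V →ₗ[ℝ] V) (v : V) : ExtForms V →ₗ[ℂ] ExtForms V :=
  interior v + I • interior (J v)

lemma contractHol_apply (v : V) (φ : ExtForms V) :
    contractHol J v φ = interior v φ - I • interior (J v) φ := rfl

lemma contractAnti_apply (v : V) (φ : ExtForms V) :
    contractAnti J v φ = interior v φ + I • interior (J v) φ := rfl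

lemma contractHol_wedge (v : V) (η : V →ₗ[ℝ] ℂ) (φ : ExtForms V) :
    contractHol J v (wedge η φ) = (η v - I * η (J v)) • φ - wedge η (contractHol J v φ) := by
  simp only [contractHol_apply, interior_wedge, map_sub, map_smul]
  module

lemma contractAnti_wedge (v : V) (η : V →ₗ[ℝ] ℂ) (φ : ExtForms V) :
    contractAnti J v (wedge η φ) = (η v + I * η (J v)) • φ - wedge η (contractAnti J v φ) := by
  simp only [contractAnti_apply, interior_wedge, map_add, map_smul]
  module

lemma contractHol_wedge_left {ξ : V →ₗ[ℝ] ℂ} (hξ : ∀ v, ξ (J v) = I * ξ v) (v : V)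
    (φ : ExtForms V) :
    contractHol J v (wedge ξ φ) = (2 * ξ v) • φ - wedge ξ (contractHol J v φ) := by
  rw [contractHol_wedge, hξ, ← mul_assoc, Complex.I_mul_I]
  ring_nf

lemma contractHol_wedge_right {η : V →ₗ[ℝ] ℂ} (hη : ∀ v, η (J v) = -I * η v) (v : V)
    (φ : ExtForms V) :
    contractHol J v (wedge η φ) = -wedge η (contractHol J v φ) := by
  rw [contractHol_wedge, hη, ← mul_assoc, mul_neg, Complex.I_mul_I]
  simp

lemma contractAnti_wedge_left {ξ : V →ₗ[ℝ] ℂ} (hξ : ∀ v, ξ (J v) = I * ξ v) (v : V)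
    (φ : ExtForms V) :
    contractAnti J v (wedge ξ φ) = -wedge ξ (contractAnti J v φ) := by
  rw [contractAnti_wedge, hξ, ← mul_assoc, Complex.I_mul_I]
  simp

lemma contractAnti_wedge_right {η : V →ₗ[ℝ] ℂ} (hη : ∀ v, η (J v) = -I * η v) (v : V)
    (φ : ExtForms V) :
    contractAnti J v (wedge η φ) = (2 * η v) • φ - wedge η (contractAnti J v φ) := by
  rw [contractAnti_wedge, hη, ← mul_assoc, mul_neg, Complex.I_mul_I]
  ring_nf

lemma contractHol_unitForm (v : V) : contractHol J v unitForm = 0 := by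
  simp [contractHol_apply, interior_unitForm]

lemma contractAnti_unitForm (v : V) : contractAnti J v unitForm = 0 := by
  simp [contractAnti_apply, interior_unitForm]

lemma contractAnti_interior (v w : V) (φ : ExtForms V) :
    contractAnti J v (interior w φ) = -interior w (contractAnti J v φ) := by
  rw [contractAnti_apply, contractAnti_apply, map_add, map_smul, interior_interior v,
    interior_interior (J v)]
  module

lemma contractAnti_contractHol (v w : V) (φ : ExtForms V) :
    contractAnti J v (contractHol J w φ) = -contractHol J w (contractAnti J v φ) := by
  rw [contractHol_apply, contractHol_apply, map_sub, map_smul, contractAnti_interior,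
    contractAnti_interior]
  module

/-- Vectors of type `(1,0)` pair to zero with covectors of type `(0,1)`, so the contraction
anticommutes past every factor down to the constant. -/
lemma contractHol_eq_zero (v : V) {q : ℕ} {φ : ExtForms V}
    (hφ : φ ∈ typeForms J (0 : ℕ) q) : contractHol J v φ = 0 := by
  suffices typeForms J (0 : ℕ) q ≤ LinearMap.ker (contractHol J v) from this hφ
  rw [typeForms_le_iff]
  rintro a b ha rfl - hb
  obtain rfl := List.length_eq_zero_iff.1 ha
  rw [List.nil_append, LinearMap.mem_ker]
  clear hφ
  induction b with
  | nil => exact contractHol_unitForm v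
  | cons η b ih =>
    simp only [List.forall_mem_cons] at hb
    rw [wedgeList, List.foldr_cons, contractHol_wedge_right hb.1]
    simp [ih hb.2]

lemma contractHol_mem_typeForms (v : V) {p q : ℕ} {φ : ExtForms V}
    (hφ : φ ∈ typeForms J (p + 1 : ℕ) q) : contractHol J v φ ∈ typeForms J p q := by
  -- The integer `a.length - 1` lets the induction start at the empty list, where the contraction
  -- vanishes and the target is the zero space.
  suffices H : ∀ a b : List (V →ₗ[ℝ] ℂ),
      (∀ ξ ∈ a, ∀ v, ξ (J v) = I * ξ v) → (∀ η ∈ b, ∀ v, η (J v) = -I * η v) →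
      contractHol J v (wedgeList (a ++ b)) ∈ typeForms J (a.length - 1 : ℤ) b.length by
    have : typeForms J (p + 1 : ℕ) q ≤ (typeForms J p q).comap (contractHol J v) := by
      rw [typeForms_le_iff]
      rintro a b hp rfl ha hb
      have := H a b ha hb
      rw [hp] at this
      simpa using this
    exact this hφ
  intro a b ha hb
  induction a with
  | nil =>
    have h0 : contractHol J v (wedgeList b) = 0 :=
      contractHol_eq_zero v (wedgeList_mem_typeForms (a := []) (by simp) hb)
    simp [h0]
  | cons ξ a ih =>
    simp only [List.forall_mem_cons] at ha
    have ih := ih ha.2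
    rw [List.cons_append, wedgeList, List.foldr_cons, contractHol_wedge_left ha.1]
    simp only [List.length_cons, Nat.cast_add, Nat.cast_one, add_sub_cancel_right]
    refine Submodule.sub_mem _ (Submodule.smul_mem _ _ (wedgeList_mem_typeForms ha.2 hb)) ?_
    -- For empty `a` the induction hypothesis lives in type `(-1, q)`, so the remaining term is
    -- zero; otherwise the exterior product with `ξ` restores the lost degree.
    cases a with
    | nil =>
      rw [typeForms_eq_bot (by simp), Submodule.mem_bot] at ih
      rw [ih]
      simp
    | cons ξ' a =>
      simp only [List.length_cons, Nat.cast_add, Nat.cast_one, add_sub_cancel_right] at ih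
      simpa using wedge_mem_typeForms_left ha.1 ih

lemma contractAnti_eq_zero (v : V) {p : ℕ} {φ : ExtForms V}
    (hφ : φ ∈ typeForms J p (0 : ℕ)) : contractAnti J v φ = 0 := by
  suffices typeForms J p (0 : ℕ) ≤ LinearMap.ker (contractAnti J v) from this hφ
  rw [typeForms_le_iff]
  rintro a b rfl hb ha -
  obtain rfl := List.length_eq_zero_iff.1 hb
  rw [List.append_nil, LinearMap.mem_ker]
  clear hb hφ
  induction a with
  | nil => exact contractAnti_unitForm v
  | cons ξ a ih =>
    simp only [List.forall_mem_cons] at ha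
    rw [wedgeList, List.foldr_cons, contractAnti_wedge_left ha.1]
    simp [ih ha.2]

/-! ### Complex frames and number operators -/

/-- A complex basis `e` of `(V, J)` together with its dual basis `ξ` of covectors of type `(1, 0)`. -/
structure ComplexFrame (J : V →ₗ[ℝ] V) (n : ℕ) where
  e : Fin n → V
  ξ : Fin n → V →ₗ[ℝ] ℂ
  type : ∀ j v, ξ j (J v) = I * ξ j v
  dual : ∀ j, ξ j (e j) = 1
  expand : ∀ v, v = ∑ j, ((ξ j v).re • e j + (ξ j v).im • J (e j))

/-- `J` makes `V` a complex vector space of half the real dimension; the frame is a complex basis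
with its coordinate functionals, and `expand` is the basis expansion split into real and imaginary
parts. -/
lemma exists_complexFrame (hJ : ∀ v, J (J v) = -v) [FiniteDimensional ℝ V] {n : ℕ}
    (hn : Module.finrank ℝ V = 2 * n) : Nonempty (ComplexFrame J n) := by
  have hJ2 : J * J = -1 := LinearMap.ext hJ
  let F : ℂ →ₐ[ℝ] Module.End ℝ V := Complex.lift ⟨J, hJ2⟩
  have hF (z : ℂ) (v : V) : F z v = z.re • v + z.im • J v := by
    simp [F, Complex.liftAux_apply, Module.algebraMap_end_apply]
  let _ : Module ℂ V := Module.compHom V F.toRingHom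
  have hsmul (z : ℂ) (v : V) : z • v = z.re • v + z.im • J v := hF z v
  have : IsScalarTower ℝ ℂ V := ⟨fun r z v => by
    simp only [hsmul, Complex.smul_re, Complex.smul_im, smul_add, smul_assoc]⟩
  have : FiniteDimensional ℂ V := Module.Finite.right ℝ ℂ V
  have hfr : Module.finrank ℂ V = n := by
    have := Module.finrank_mul_finrank ℝ ℂ V
    rw [Complex.finrank_real_complex, hn] at this
    omega
  let b := Module.finBasisOfFinrankEq ℂ V hfr
  refine ⟨⟨b, fun j => (b.coord j).restrictScalars ℝ, fun j v => ?_, fun j => ?_, fun v => ?_⟩⟩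
  · have : J v = I • v := by simp [hsmul]
    simp [this]
  · simp
  · conv_lhs => rw [← b.sum_repr v]
    exact Finset.sum_congr rfl fun j _ => hsmul _ _

namespace ComplexFrame

variable {n : ℕ} (F : ComplexFrame J n)

lemma eq_sum {θ : V →ₗ[ℝ] ℂ} (hθ : ∀ v, θ (J v) = I * θ v) : θ = ∑ j, θ (F.e j) • F.ξ j := by
  ext v
  conv_lhs => rw [F.expand v]
  simp only [map_sum, map_add, map_smul, hθ, LinearMap.sum_apply, LinearMap.smul_apply,
    smul_eq_mul, Complex.real_smul]
  refine Finset.sum_congr rfl fun j _ => ?_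
  conv_rhs => rw [← Complex.re_add_im (F.ξ j v)]
  ring

/-- The operator `∑ⱼ ξⱼ ∧ ι_{eⱼ - i J eⱼ}`, which multiplies forms of type `(p, q)` by `2p`. -/
def number : ExtForms V →ₗ[ℂ] ExtForms V := ∑ j, wedge (F.ξ j) ∘ₗ contractHol J (F.e j)

lemma number_apply (φ : ExtForms V) :
    F.number φ = ∑ j, wedge (F.ξ j) (contractHol J (F.e j) φ) := by
  simp [number]

/-- The operator behaves as a derivation: the signs from anticommuting the contraction and `ξⱼ` past
`θ` cancel. The factor `2` is the pairing `θ(v - iJv) = 2θ(v)`. -/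
lemma number_wedge_left {θ : V →ₗ[ℝ] ℂ} (hθ : ∀ v, θ (J v) = I * θ v) (φ : ExtForms V) :
    F.number (wedge θ φ) = (2 : ℂ) • wedge θ φ + wedge θ (F.number φ) := by
  have h : wedge θ φ = ∑ j, θ (F.e j) • wedge (F.ξ j) φ := by
    conv_lhs => rw [F.eq_sum hθ]
    simp [wedge_sum_left, wedge_smul_left]
  rw [number_apply]
  simp only [contractHol_wedge_left hθ, map_sub, map_smul, wedge_wedge _ θ, sub_neg_eq_add,
    Finset.sum_add_distrib, mul_smul]
  rw [← Finset.smul_sum, ← h, number_apply, map_sum]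

lemma number_of_mem {p q : ℕ} {φ : ExtForms V} (hφ : φ ∈ typeForms J p q) :
    F.number φ = (2 * p : ℂ) • φ := by
  suffices typeForms J p q ≤ LinearMap.ker (F.number - (2 * p : ℂ) • LinearMap.id) by
    simpa [sub_eq_zero] using this hφ
  rw [typeForms_le_iff]
  rintro a b rfl rfl ha hb
  clear hφ
  rw [LinearMap.mem_ker, LinearMap.sub_apply, sub_eq_zero, LinearMap.smul_apply, LinearMap.id_apply]
  induction a with
  | nil =>
    have h0 (v : V) : contractHol J v (wedgeList b) = 0 :=
      contractHol_eq_zero v (wedgeList_mem_typeForms (a := []) (by simp) hb)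
    simp [number_apply, h0]
  | cons θ a ih =>
    simp only [List.forall_mem_cons] at ha
    rw [List.cons_append, wedgeList, List.foldr_cons, F.number_wedge_left ha.1]
    have := ih ha.2
    rw [wedgeList] at this
    rw [this, map_smul, List.length_cons]
    push_cast
    module

/-- Each anticommutator of `ξⱼ ∧` with its contraction is `2ξⱼ(eⱼ) = 2`, so this sum and the number
operator add up to `2n`. It measures the missing `(1,0)`-factors, and for `p ≠ n` it recovers `φ`
from the forms `ξⱼ ∧ φ` of type `(p+1,q)`. -/
lemma sum_contractHol_wedge {p q : ℕ} {φ : ExtForms V} (hφ : φ ∈ typeForms J p q) :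
    ∑ j, contractHol J (F.e j) (wedge (F.ξ j) φ) = (2 * (n - p) : ℂ) • φ := by
  have h := F.number_of_mem hφ
  rw [number_apply] at h
  simp only [contractHol_wedge_left (F.type _), F.dual, Finset.sum_sub_distrib, h]
  simp only [mul_one, Finset.sum_const, Finset.card_univ, Fintype.card_fin]
  module

end ComplexFrame

/-- Evaluation of the component of degree `k` on vectors. -/
def evalAt (k : ℕ) (w : Fin k → V) : ExtForms V →ₗ[ℂ] ℂ where
  toFun φ := φ k w
  map_add' _ _ := rfl
  map_smul' _ _ := rfl

lemma evalAt_apply (k : ℕ) (w : Fin k → V) (φ : ExtForms V) : evalAt k w φ = φ k w := rfl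

namespace ComplexFrame

variable {n : ℕ}

/-- Vanishing of the `(0,1)`-contractions says `ι_{Jv} φ = i ι_v φ`: contraction is complex linear
in `v`, and can be expanded in the complex basis. -/
lemma interior_eq_sum (F : ComplexFrame J n) {φ : ExtForms V} (h : ∀ v, contractAnti J v φ = 0) (v : V) :
    interior v φ = ∑ j, F.ξ j v • interior (F.e j) φ := by
  have hJ (w : V) : interior (J w) φ = I • interior w φ := by
    have := congrArg (fun χ => I • χ) (h w)
    simp only [contractAnti_apply, smul_add, smul_smul, Complex.I_mul_I, smul_zero] at this
    rw [neg_one_smul, ← sub_eq_add_neg, sub_eq_zero] at this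
    exact this.symm
  conv_lhs => rw [F.expand v]
  rw [interior_sum]
  refine Finset.sum_congr rfl fun j _ => ?_
  rw [interior_add, interior_smul, interior_smul, hJ, smul_smul, ← add_smul, Complex.re_add_im]

/-- Euler's identity for forms that are annihilated by all vectors of type `(0, 1)`. -/
lemma smul_eq_sum_wedge_interior (F : ComplexFrame J n) {d : ℕ} {φ : ExtForms V} (hd : φ ∈ degreeForms V d)
    (h : ∀ v, contractAnti J v φ = 0) :
    (d : ℂ) • φ = ∑ j, wedge (F.ξ j) (interior (F.e j) φ) := by
  funext k
  ext w
  rw [← evalAt_apply, ← evalAt_apply, map_smul, map_sum, smul_eq_mul]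
  simp only [evalAt_apply]
  -- Components of degree other than `d` vanish, so the factor may be read as the index `k` of the
  -- component being evaluated.
  have hk : (d : ℂ) * φ k w = (k : ℂ) * φ k w := by
    rcases eq_or_ne k d with rfl | hne
    · rfl
    · simp [hd _ hne]
  rw [hk]
  cases k with
  | zero => simp [wedge_zero]
  | succ k =>
    -- The sum over the frame is `ι_{w i} φ`; moving `w i` back to position `i` produces a second
    -- `(-1)^i`. Each of the `k + 1` terms of the exterior product therefore equals `φ`.
    have key (i : Fin (k + 1)) : (-1) ^ (i : ℕ) *
        ∑ j, F.ξ j (w i) * interior (F.e j) φ k (i.removeNth w) = φ (k + 1) w := by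
      have h1 := congrArg (evalAt k (i.removeNth w)) (F.interior_eq_sum h (w i))
      simp only [map_sum, map_smul, evalAt_apply, smul_eq_mul] at h1
      rw [← h1, interior_apply]
      have h2 := (φ (k + 1)).map_insertNth i (w i) (i.removeNth w)
      rw [Fin.insertNth_self_removeNth] at h2
      rw [h2]
      simp [Matrix.vecCons]
    simp only [wedge_succ]
    rw [Finset.sum_comm]
    simp only [← Finset.mul_sum, key]
    simp

/-- Induction on the degree through Euler's identity: the contractions of `φ` are again killed by
`(0,1)`-vectors, and wedging them with the `ξⱼ` rebuilds a nonzero multiple of `φ`. -/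
lemma mem_typeForms_of_contractAnti (F : ComplexFrame J n) {d : ℕ} {φ : ExtForms V} (hd : φ ∈ degreeForms V d)
    (h : ∀ v, contractAnti J v φ = 0) : φ ∈ typeForms J d (0 : ℕ) := by
  induction d generalizing φ with
  | zero =>
    rw [eq_smul_unitForm hd]
    exact Submodule.smul_mem _ _ (wedgeList_mem_typeForms (a := []) (b := []) (by simp) (by simp))
  | succ d ih =>
    have hne : ((d + 1 : ℕ) : ℂ) ≠ 0 := Nat.cast_ne_zero.2 d.succ_ne_zero
    rw [← Submodule.smul_mem_iff _ hne, F.smul_eq_sum_wedge_interior hd h]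
    refine Submodule.sum_mem _ fun j _ => wedge_mem_typeForms_left (F.type j)
      (ih (interior_mem_degreeForms _ hd) fun v => ?_)
    rw [contractAnti_interior, h, map_zero, neg_zero]

/-- Downward induction on `p`, starting above the real dimension: if all forms of type `(p+1,q)`
vanish, `sum_contractHol_wedge` leaves `2(n - p) φ = 0` with `p ≠ n`. -/
lemma typeForms_eq_bot_of_lt [FiniteDimensional ℝ V] (F : ComplexFrame J n) {p : ℕ} (hp : n < p) (q : ℕ) :
    typeForms J p q = ⊥ := by
  suffices H : ∀ m p : ℕ, n < p → Module.finrank ℝ V < p + m → typeForms J p q = ⊥ from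
    H (Module.finrank ℝ V + 1) p hp (by omega)
  intro m
  induction m with
  | zero =>
    intro p _ hV
    rw [eq_bot_iff]
    exact fun φ hφ => eq_zero_of_mem_degreeForms (d := p + q) (by omega)
      (typeForms_le_degreeForms p q hφ)
  | succ m ih =>
    intro p hp hV
    rw [eq_bot_iff]
    intro φ hφ
    have h := F.sum_contractHol_wedge hφ
    have h0 (j : Fin n) : wedge (F.ξ j) φ = 0 := by
      have := wedge_mem_typeForms_left (F.type j) hφ
      rwa [ih (p + 1) (by omega) (by omega), Submodule.mem_bot] at this
    simp only [h0, map_zero, Finset.sum_const_zero] at h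
    refine (smul_eq_zero.1 h.symm).resolve_left (mul_ne_zero two_ne_zero (sub_ne_zero.2 ?_))
    exact_mod_cast hp.ne

/-- A form annihilated by the vectors of type `(0, 1)` and the covectors of type `(1, 0)` is of
type `(n, 0)`. -/
lemma mem_typeForms_top (F : ComplexFrame J n) {ρ : ExtForms V} (h : ∀ v, contractAnti J v ρ = 0)
    (hw : ∀ ξ : V →ₗ[ℝ] ℂ, (∀ v, ξ (J v) = I * ξ v) → wedge ξ ρ = 0) :
    ρ ∈ typeForms J n (0 : ℕ) := by
  -- Contraction shifts degrees uniformly, so each homogeneous component satisfies the hypotheses by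
  -- itself.
  have hc (d : ℕ) : component d ρ ∈ typeForms J d (0 : ℕ) := by
    refine F.mem_typeForms_of_contractAnti (component_mem d ρ) fun v => ?_
    cases d with
    | zero => simp [contractAnti_apply, interior_component_zero]
    | succ d =>
      have := congrArg (component d) (h v)
      rw [contractAnti_apply, map_add, map_smul, map_zero] at this
      rw [contractAnti_apply, interior_component, interior_component, this]
  -- The component of degree `d` has type `(d,0)` and all `ξⱼ ∧` kill it, so `2(n - d)` times it is
  -- zero.
  have h0 (d : ℕ) (hd : d ≠ n) : component d ρ = 0 := by
    have := F.sum_contractHol_wedge (hc d)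
    simp only [wedge_component, hw _ (F.type _), map_zero, Finset.sum_const_zero] at this
    refine (smul_eq_zero.1 this.symm).resolve_left (mul_ne_zero two_ne_zero (sub_ne_zero.2 ?_))
    exact_mod_cast hd.symm
  have : component n ρ = ρ := component_of_mem fun k hk => by
    rw [← component_same k ρ, h0 k hk]
    rfl
  exact this ▸ hc n

end ComplexFrame

/-! ### The eigenspaces of the block structure -/

lemma exists_eq_tmul {M : Type*} [AddCommGroup M] [Module ℝ M] (w : ℂ ⊗[ℝ] M) :
    ∃ u u' : M, w = (1 : ℂ) ⊗ₜ[ℝ] u + I ⊗ₜ[ℝ] u' := by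
  induction w using TensorProduct.induction_on with
  | zero => exact ⟨0, 0, by simp⟩
  | tmul z u =>
    refine ⟨z.re • u, z.im • u, ?_⟩
    rw [← TensorProduct.smul_tmul, ← TensorProduct.smul_tmul, ← TensorProduct.add_tmul]
    congr 1
    conv_lhs => rw [← Complex.re_add_im z]
    simp
  | add w w' h h' =>
    obtain ⟨u, v, rfl⟩ := h
    obtain ⟨u', v', rfl⟩ := h'
    exact ⟨u + u', v + v', by rw [TensorProduct.tmul_add, TensorProduct.tmul_add]; abel⟩

variable [TopologicalSpace V]

lemma cliffordActC_tmul (z : ℂ) (u : V × (V →L[ℝ] ℝ)) (φ : ExtForms V) :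
    cliffordActC (z ⊗ₜ[ℝ] u) φ = z • cliffordAct u φ := by
  simp [cliffordActC]

lemma conjC_tmul (z : ℂ) (u : V × (V →L[ℝ] ℝ)) :
    conjC (z ⊗ₜ[ℝ] u) = (starRingEnd ℂ z) ⊗ₜ[ℝ] u := rfl

section Eigen

variable {𝒥 : V × (V →L[ℝ] ℝ) →ₗ[ℝ] V × (V →L[ℝ] ℝ)}

lemma conjC_conjC (w : ℂ ⊗[ℝ] (V × (V →L[ℝ] ℝ))) : conjC (conjC w) = w := by
  obtain ⟨u, u', rfl⟩ := exists_eq_tmul w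
  simp [conjC_tmul]

lemma smul_I_tmul_I (u : V × (V →L[ℝ] ℝ)) : I • (I ⊗ₜ[ℝ] u) = -((1 : ℂ) ⊗ₜ[ℝ] u) := by
  rw [TensorProduct.smul_tmul', smul_eq_mul, Complex.I_mul_I, TensorProduct.neg_tmul]

lemma smul_I_tmul_one (u : V × (V →L[ℝ] ℝ)) : I • ((1 : ℂ) ⊗ₜ[ℝ] u) = I ⊗ₜ[ℝ] u := by
  rw [TensorProduct.smul_tmul', smul_eq_mul, mul_one]

lemma sub_mem_eigenL (h𝒥 : ∀ u, 𝒥 (𝒥 u) = -u) (u : V × (V →L[ℝ] ℝ)) :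
    (1 : ℂ) ⊗ₜ[ℝ] u - I ⊗ₜ[ℝ] 𝒥 u ∈ eigenL 𝒥 := by
  rw [eigenL, Module.End.mem_eigenspace_iff, smul_sub, smul_I_tmul_I, smul_I_tmul_one]
  simp only [map_sub, LinearMap.baseChange_tmul, h𝒥, TensorProduct.tmul_neg]
  abel

/-- Every element of the complexification is the sum of one in `L` and one in its conjugate. -/
lemma exists_eq_eigen_add (h𝒥 : ∀ u, 𝒥 (𝒥 u) = -u) (w : ℂ ⊗[ℝ] (V × (V →L[ℝ] ℝ))) :
    ∃ u u', w = ((1 : ℂ) ⊗ₜ[ℝ] u - I ⊗ₜ[ℝ] 𝒥 u) + ((1 : ℂ) ⊗ₜ[ℝ] u' + I ⊗ₜ[ℝ] 𝒥 u') := by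
  obtain ⟨a, b, rfl⟩ := exists_eq_tmul w
  -- These are the real parts of the projections `(1 ∓ i𝒥)/2` applied to `a + ib`.
  refine ⟨(2⁻¹ : ℝ) • (a + 𝒥 b), (2⁻¹ : ℝ) • (a - 𝒥 b), ?_⟩
  simp only [map_smul, map_add, map_sub, h𝒥, TensorProduct.tmul_smul, TensorProduct.tmul_add,
    TensorProduct.tmul_sub, TensorProduct.tmul_neg]
  module

/-- In the decomposition of `w ∈ L` the second summand lies in both the `i`- and the
`-i`-eigenspace, hence vanishes. -/
lemma mem_eigenL_iff (h𝒥 : ∀ u, 𝒥 (𝒥 u) = -u) {w : ℂ ⊗[ℝ] (V × (V →L[ℝ] ℝ))} :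
    w ∈ eigenL 𝒥 ↔ ∃ u, w = (1 : ℂ) ⊗ₜ[ℝ] u - I ⊗ₜ[ℝ] 𝒥 u := by
  refine ⟨fun h => ?_, ?_⟩
  · obtain ⟨u, u', rfl⟩ := exists_eq_eigen_add h𝒥 w
    refine ⟨u, ?_⟩
    have h1 := (Submodule.add_mem_iff_right _ (sub_mem_eigenL h𝒥 u)).1 h
    rw [eigenL, Module.End.mem_eigenspace_iff, smul_add, smul_I_tmul_I, smul_I_tmul_one] at h1
    simp only [map_add, LinearMap.baseChange_tmul, h𝒥, TensorProduct.tmul_neg] at h1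
    have h2 : (2 : ℂ) • ((1 : ℂ) ⊗ₜ[ℝ] u' + I ⊗ₜ[ℝ] 𝒥 u') = 0 := by
      have h3 := congrArg (fun x => I • x) h1
      simp only [smul_add, smul_neg, smul_I_tmul_I, smul_I_tmul_one] at h3
      rw [neg_neg] at h3
      rw [two_smul]
      nth_rewrite 1 [add_comm ((1 : ℂ) ⊗ₜ[ℝ] u'), h3]
      abel
    rw [(smul_eq_zero.1 h2).resolve_left two_ne_zero, add_zero]
  · rintro ⟨u, rfl⟩
    exact sub_mem_eigenL h𝒥 u

lemma conjC_mem_eigenL_iff (h𝒥 : ∀ u, 𝒥 (𝒥 u) = -u) {w : ℂ ⊗[ℝ] (V × (V →L[ℝ] ℝ))} :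
    conjC w ∈ eigenL 𝒥 ↔ ∃ u, w = (1 : ℂ) ⊗ₜ[ℝ] u + I ⊗ₜ[ℝ] 𝒥 u := by
  have hc (u : V × (V →L[ℝ] ℝ)) : conjC ((1 : ℂ) ⊗ₜ[ℝ] u - I ⊗ₜ[ℝ] 𝒥 u) =
      (1 : ℂ) ⊗ₜ[ℝ] u + I ⊗ₜ[ℝ] 𝒥 u := by
    simp [conjC_tmul, TensorProduct.neg_tmul]
  rw [mem_eigenL_iff h𝒥]
  refine exists_congr fun u => ⟨fun h => ?_, fun h => ?_⟩
  · rw [← conjC_conjC w, h, hc]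
  · rw [h, ← hc, conjC_conjC]

lemma spinorLine_le_gradedU {n : ℕ} :
    spinorLine 𝒥 ≤ gradedU 𝒥 n n := fun ρ hρ =>
  Submodule.subset_span ⟨[], ρ, by simp, by simp, hρ, rfl⟩

lemma cliffordActC_mem_gradedU {n : ℕ}
    {w : ℂ ⊗[ℝ] (V × (V →L[ℝ] ℝ))} (hw : conjC w ∈ eigenL 𝒥) {k : ℤ} {φ : ExtForms V}
    (hφ : φ ∈ gradedU 𝒥 n k) : cliffordActC w φ ∈ gradedU 𝒥 n (k - 1) := by
  suffices gradedU 𝒥 n k ≤ (gradedU 𝒥 n (k - 1)).comap (cliffordActC w) from this hφ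
  refine Submodule.span_le.2 ?_
  rintro _ ⟨l, ρ, hl, hL, hρ, rfl⟩
  exact Submodule.subset_span ⟨w :: l, ρ, by push_cast [List.length_cons]; omega,
    List.forall_mem_cons.2 ⟨hw, hL⟩, hρ, rfl⟩

end Eigen

/-! ### The Clifford action of `L` and `L̄` for the block structure -/

variable {A : V →L[ℝ] V}

/-- The covector `f - i A* f`, of type `(1, 0)`. -/
def covectorHol (A : V →L[ℝ] V) (f : V →L[ℝ] ℝ) : V →ₗ[ℝ] ℂ :=
  Complex.ofRealCLM.toLinearMap ∘ₗ f.toLinearMap -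
    I • (Complex.ofRealCLM.toLinearMap ∘ₗ (f.comp A).toLinearMap)

/-- The covector `f + i A* f`, of type `(0, 1)`. -/
def covectorAnti (A : V →L[ℝ] V) (f : V →L[ℝ] ℝ) : V →ₗ[ℝ] ℂ :=
  Complex.ofRealCLM.toLinearMap ∘ₗ f.toLinearMap +
    I • (Complex.ofRealCLM.toLinearMap ∘ₗ (f.comp A).toLinearMap)

lemma covectorHol_apply (f : V →L[ℝ] ℝ) (v : V) : covectorHol A f v = f v - I * f (A v) := rfl

lemma covectorAnti_apply (f : V →L[ℝ] ℝ) (v : V) : covectorAnti A f v = f v + I * f (A v) := rfl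

lemma covectorHol_type (hA : ∀ v, A (A v) = -v) (f : V →L[ℝ] ℝ) (v : V) :
    covectorHol A f (A v) = I * covectorHol A f v := by
  simp only [covectorHol_apply, hA, map_neg, Complex.ofReal_neg]
  linear_combination (f (A v)) * Complex.I_mul_I

lemma covectorAnti_type (hA : ∀ v, A (A v) = -v) (f : V →L[ℝ] ℝ) (v : V) :
    covectorAnti A f (A v) = -I * covectorAnti A f v := by
  simp only [covectorAnti_apply, hA, map_neg, Complex.ofReal_neg]
  linear_combination (f (A v)) * Complex.I_mul_I

variable [IsTopologicalAddGroup V]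

lemma blockMap_blockMap (hA : ∀ v, A (A v) = -v) (u : V × (V →L[ℝ] ℝ)) :
    (blockMap A).toLinearMap ((blockMap A).toLinearMap u) = -u := by
  refine Prod.ext ?_ ?_
  · change -(A (-(A u.1))) = -u.1
    simp [hA]
  · ext v
    change u.2 (A (A v)) = -(u.2 v)
    simp [hA]

/-- Identifies `L` as `T^{0,1} ⊕ (T*)^{1,0}`: the sign in `-A` turns `v - i𝒥v` into the
`(0,1)`-vector `v + iAv`. -/
lemma cliffordActC_eigen (u : V × (V →L[ℝ] ℝ)) (φ : ExtForms V) :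
    cliffordActC ((1 : ℂ) ⊗ₜ[ℝ] u - I ⊗ₜ[ℝ] (blockMap A).toLinearMap u) φ =
      contractAnti A.toLinearMap u.1 φ + wedge (covectorHol A u.2) φ := by
  rw [map_sub, LinearMap.sub_apply, cliffordActC_tmul, cliffordActC_tmul, one_smul, covectorHol,
    sub_eq_add_neg (_ ∘ₗ _), ← neg_smul, wedge_add_left, wedge_smul_left]
  change interior u.1 φ + wedge _ φ - I • (interior (-(A u.1)) φ + wedge _ φ) =
    interior u.1 φ + I • interior (A u.1) φ + _
  rw [interior_neg]
  change _ + _ - I • (_ + wedge (Complex.ofRealCLM.toLinearMap ∘ₗ (u.2.comp A).toLinearMap) φ) = _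
  module

lemma cliffordActC_conj_eigen (u : V × (V →L[ℝ] ℝ)) (φ : ExtForms V) :
    cliffordActC ((1 : ℂ) ⊗ₜ[ℝ] u + I ⊗ₜ[ℝ] (blockMap A).toLinearMap u) φ =
      contractHol A.toLinearMap u.1 φ + wedge (covectorAnti A u.2) φ := by
  rw [map_add, LinearMap.add_apply, cliffordActC_tmul, cliffordActC_tmul, one_smul, covectorAnti,
    wedge_add_left, wedge_smul_left]
  change interior u.1 φ + wedge _ φ + I • (interior (-(A u.1)) φ + wedge _ φ) =
    interior u.1 φ - I • interior (A u.1) φ + _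
  rw [interior_neg]
  change _ + _ + I • (_ + wedge (Complex.ofRealCLM.toLinearMap ∘ₗ (u.2.comp A).toLinearMap) φ) = _
  module

/-! ### The spaces `U^k` in terms of types -/

variable {n : ℕ}

lemma contractHol_mem_gradedU (hA : ∀ v, A (A v) = -v) (v : V)
    {k : ℤ} {φ : ExtForms V} (hφ : φ ∈ gradedU (blockMap A).toLinearMap n k) :
    contractHol A.toLinearMap v φ ∈ gradedU (blockMap A).toLinearMap n (k - 1) := by
  have h0 : wedge (covectorAnti A 0) φ = 0 := by
    have : covectorAnti A 0 = (0 : ℂ) • (0 : V →ₗ[ℝ] ℂ) := by ext; simp [covectorAnti_apply]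
    rw [this, wedge_smul_left, zero_smul]
  have h := cliffordActC_mem_gradedU
    ((conjC_mem_eigenL_iff (blockMap_blockMap hA)).2 ⟨(v, 0), rfl⟩) hφ
  rwa [cliffordActC_conj_eigen, h0, add_zero] at h

/-- An element of `L̄` sends type `(p,q)` into `(p-1,q)` plus `(p,q+1)`. With natural indices `p =
0` is separate: there the contraction is zero. -/
lemma cliffordActC_mem_iSup_typeForms (hA : ∀ v, A (A v) = -v) (u : V × (V →L[ℝ] ℝ)) {k : ℤ}
    {φ : ExtForms V} (hφ : φ ∈ ⨆ a : {a : ℕ × ℕ // (a.1 : ℤ) - a.2 = k},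
      typeForms A.toLinearMap a.1.1 a.1.2) :
    cliffordActC ((1 : ℂ) ⊗ₜ[ℝ] u + I ⊗ₜ[ℝ] (blockMap A).toLinearMap u) φ ∈
      ⨆ a : {a : ℕ × ℕ // (a.1 : ℤ) - a.2 = k - 1}, typeForms A.toLinearMap a.1.1 a.1.2 := by
  suffices (⨆ a : {a : ℕ × ℕ // (a.1 : ℤ) - a.2 = k}, typeForms A.toLinearMap a.1.1 a.1.2) ≤
      (⨆ a : {a : ℕ × ℕ // (a.1 : ℤ) - a.2 = k - 1},
        typeForms A.toLinearMap a.1.1 a.1.2).comap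
      (cliffordActC ((1 : ℂ) ⊗ₜ[ℝ] u + I ⊗ₜ[ℝ] (blockMap A).toLinearMap u)) from this hφ
  refine iSup_le ?_
  rintro ⟨⟨p, q⟩, hpq⟩ φ hφ
  dsimp only at hpq hφ
  rw [Submodule.mem_comap, cliffordActC_conj_eigen]
  refine Submodule.add_mem _ ?_ ?_
  · cases p with
    | zero => rw [contractHol_eq_zero _ hφ]; exact Submodule.zero_mem _
    | succ p =>
      exact Submodule.mem_iSup_of_mem ⟨(p, q), by push_cast at hpq ⊢; omega⟩
        (contractHol_mem_typeForms _ hφ)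
  · exact Submodule.mem_iSup_of_mem ⟨(p, q + 1), by push_cast; omega⟩
      (wedge_mem_typeForms_right (J := A.toLinearMap) (covectorAnti_type hA _) hφ)

variable [ContinuousSMul ℝ V] [T2Space V] [FiniteDimensional ℝ V]

/-- The real part determines such a covector, since `Im ξ(v) = -Re ξ(Av)`. -/
lemma exists_covectorHol_eq {ξ : V →ₗ[ℝ] ℂ} (hξ : ∀ v, ξ (A v) = I * ξ v) :
    ∃ f, ξ = covectorHol A f := by
  refine ⟨LinearMap.toContinuousLinearMap (Complex.reLm ∘ₗ ξ), LinearMap.ext fun v => ?_⟩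
  rw [covectorHol_apply]
  change ξ v = ((ξ v).re : ℂ) - I * ((ξ (A v)).re : ℂ)
  rw [hξ]
  apply Complex.ext <;> simp

lemma exists_covectorAnti_eq {η : V →ₗ[ℝ] ℂ} (hη : ∀ v, η (A v) = -I * η v) :
    ∃ f, η = covectorAnti A f := by
  refine ⟨LinearMap.toContinuousLinearMap (Complex.reLm ∘ₗ η), LinearMap.ext fun v => ?_⟩
  rw [covectorAnti_apply]
  change η v = ((η v).re : ℂ) + I * ((η (A v)).re : ℂ)
  rw [hη]
  apply Complex.ext <;> simp

/-- The forms of type `(n, 0)` are the pure spinors of the structure. -/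
lemma spinorLine_eq (hA : ∀ v, A (A v) = -v) (F : ComplexFrame A.toLinearMap n) :
    spinorLine (blockMap A).toLinearMap = typeForms A.toLinearMap n (0 : ℕ) := by
  have h𝒥 := blockMap_blockMap hA
  apply le_antisymm
  · refine Submodule.span_le.2 fun ρ hρ => ?_
    have hL (u : V × (V →L[ℝ] ℝ)) :
        contractAnti A.toLinearMap u.1 ρ + wedge (covectorHol A u.2) ρ = 0 := by
      rw [← cliffordActC_eigen]
      exact (hρ _).2 (sub_mem_eigenL h𝒥 u)
    have hv (v : V) : contractAnti A.toLinearMap v ρ = 0 := by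
      have h0 : wedge (covectorHol A 0) ρ = 0 := by
        have : covectorHol A 0 = (0 : ℂ) • (0 : V →ₗ[ℝ] ℂ) := by ext; simp [covectorHol_apply]
        rw [this, wedge_smul_left, zero_smul]
      simpa [h0] using hL (v, 0)
    refine F.mem_typeForms_top hv fun ξ hξ => ?_
    obtain ⟨f, rfl⟩ := exists_covectorHol_eq hξ
    simpa [hv] using hL (0, f)
  · intro ρ hρ
    -- Zero lies in the span trivially; `ρ ≠ 0` is needed below to show that nothing outside `L`
    -- annihilates `ρ`.
    by_cases h0 : ρ = 0
    · rw [h0]; exact Submodule.zero_mem _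
    have hv (v : V) : contractAnti A.toLinearMap v ρ = 0 := contractAnti_eq_zero v hρ
    have hw {ξ : V →ₗ[ℝ] ℂ} (hξ : ∀ v, ξ (A v) = I * ξ v) : wedge ξ ρ = 0 := by
      have := wedge_mem_typeForms_left (J := A.toLinearMap) hξ hρ
      rwa [F.typeForms_eq_bot_of_lt n.lt_succ_self, Submodule.mem_bot] at this
    have hL (u : V × (V →L[ℝ] ℝ)) :
        cliffordActC ((1 : ℂ) ⊗ₜ[ℝ] u - I ⊗ₜ[ℝ] (blockMap A).toLinearMap u) ρ = 0 := by
      rw [cliffordActC_eigen, hv, hw (covectorHol_type hA _), add_zero]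
    refine Submodule.subset_span fun w => ⟨fun h => ?_, fun h => ?_⟩
    · obtain ⟨u', u, rfl⟩ := exists_eq_eigen_add h𝒥 w
      rw [map_add, LinearMap.add_apply, hL, zero_add, cliffordActC_conj_eigen] at h
      -- Only the `L̄`-part of `w` remains. A `(0,1)`-contraction kills its vector term and leaves
      -- `2η(v)ρ = 0`.
      have hη : covectorAnti A u.2 = 0 := by
        ext v
        have h1 := congrArg (contractAnti A.toLinearMap v) h
        rw [map_add, contractAnti_contractHol, hv, map_zero, neg_zero, zero_add,
          contractAnti_wedge_right (J := A.toLinearMap) (covectorAnti_type hA _), hv, map_zero,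
          map_zero, sub_zero] at h1
        simpa [h0] using h1
      have hu2 : u.2 = 0 := by
        ext v
        have := congrArg Complex.re (LinearMap.congr_fun hη v)
        simpa [covectorAnti_apply] using this
      have hu1 : u.1 = 0 := by
        rw [F.expand u.1]
        -- Dually, `ξⱼ ∧` kills the covector term and leaves `2ξⱼ(u.1)ρ = 0`.
        have hz (j : Fin n) : F.ξ j u.1 = 0 := by
          have h1 := congrArg (wedge (F.ξ j)) h
          have h2 := contractHol_wedge_left (F.type j) u.1 ρ
          rw [hw (F.type j), map_zero, eq_comm, sub_eq_zero] at h2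
          rw [map_add, ← h2, wedge_wedge, hw (F.type j), map_zero, neg_zero, add_zero,
            map_zero] at h1
          simpa [h0] using h1
        simp [hz]
      obtain rfl : u = 0 := Prod.ext hu1 hu2
      simpa using sub_mem_eigenL h𝒥 u'
    · obtain ⟨u, rfl⟩ := (mem_eigenL_iff h𝒥).1 h
      exact hL u

lemma wedge_mem_gradedU (hA : ∀ v, A (A v) = -v) {η : V →ₗ[ℝ] ℂ} (hη : ∀ v, η (A v) = -I * η v)
    {k : ℤ} {φ : ExtForms V} (hφ : φ ∈ gradedU (blockMap A).toLinearMap n k) :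
    wedge η φ ∈ gradedU (blockMap A).toLinearMap n (k - 1) := by
  obtain ⟨f, rfl⟩ := exists_covectorAnti_eq hη
  have h0 : contractHol A.toLinearMap 0 φ = 0 := by
    have := interior_smul 0 (0 : V) φ
    simp only [smul_zero, Complex.ofReal_zero, zero_smul] at this
    simp [contractHol_apply, this]
  have h := cliffordActC_mem_gradedU
    ((conjC_mem_eigenL_iff (blockMap_blockMap hA)).2 ⟨(0, f), rfl⟩) hφ
  rwa [cliffordActC_conj_eigen, h0, zero_add] at h

/-- Starting from `U = ⋀^{n,0}`, each further `(0,1)`-covector is an element of `L̄` and lowers the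
index by one. -/
lemma typeForms_top_le_gradedU (hA : ∀ v, A (A v) = -v) (F : ComplexFrame A.toLinearMap n)
    (q : ℕ) : typeForms A.toLinearMap n q ≤ gradedU (blockMap A).toLinearMap n (n - q) := by
  induction q with
  | zero => simpa [spinorLine_eq hA F] using spinorLine_le_gradedU (𝒥 := (blockMap A).toLinearMap) (n := n)
  | succ q ih =>
    rw [typeForms_le_iff]
    rintro a (_ | ⟨η, b⟩) ha hb hξ hη
    · simp at hb
    · rw [List.forall_mem_cons] at hη
      rw [wedgeList_append_cons]
      have hq : b.length = q := by simpa using hb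
      have := wedge_mem_gradedU hA hη.1 (ih (ha ▸ hq ▸ wedgeList_mem_typeForms hξ hη.2))
      rw [sub_sub] at this
      push_cast
      exact Submodule.smul_mem _ _ this

/-- Descending induction on `p` from `n`: `sum_contractHol_wedge` writes a nonzero multiple of `φ`
as a sum of `(1,0)`-contractions, elements of `L̄`, of forms of type `(p+1,q)`. Types with `p > n`
are zero. -/
lemma typeForms_le_gradedU (hA : ∀ v, A (A v) = -v) (F : ComplexFrame A.toLinearMap n)
    (p q : ℤ) : typeForms A.toLinearMap p q ≤ gradedU (blockMap A).toLinearMap n (p - q) := by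
  by_cases h : p < 0 ∨ q < 0
  · rw [typeForms_eq_bot h]; exact bot_le
  push Not at h
  obtain ⟨h1, h2⟩ := h
  lift p to ℕ using h1
  lift q to ℕ using h2
  rcases lt_or_ge n p with hp | hp
  · rw [F.typeForms_eq_bot_of_lt hp]; exact bot_le
  induction hp using Nat.decreasingInduction with
  | self => exact typeForms_top_le_gradedU hA F q
  | of_succ p hp ih =>
    intro φ hφ
    have hne : (2 * (n - p) : ℂ) ≠ 0 := mul_ne_zero two_ne_zero (sub_ne_zero.2 (by
      exact_mod_cast hp.ne'))
    rw [← Submodule.smul_mem_iff _ hne, ← F.sum_contractHol_wedge hφ]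
    refine Submodule.sum_mem _ fun j _ => ?_
    have := contractHol_mem_gradedU hA (F.e j) (ih (wedge_mem_typeForms_left (F.type j) hφ))
    have e : ((p + 1 : ℕ) : ℤ) - q - 1 = p - q := by push_cast; ring
    rwa [e] at this

lemma gradedU_le (hA : ∀ v, A (A v) = -v) (F : ComplexFrame A.toLinearMap n) (k : ℤ) :
    gradedU (blockMap A).toLinearMap n k ≤
      ⨆ a : {a : ℕ × ℕ // (a.1 : ℤ) - a.2 = k}, typeForms A.toLinearMap a.1.1 a.1.2 := by
  refine Submodule.span_le.2 ?_
  rintro _ ⟨l, ρ, hl, hL, hρ, rfl⟩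
  obtain rfl : k = n - l.length := by omega
  clear hl
  induction l with
  | nil =>
    rw [spinorLine_eq hA F] at hρ
    exact Submodule.mem_iSup_of_mem ⟨(n, 0), by simp⟩ hρ
  | cons w l ih =>
    rw [List.forall_mem_cons] at hL
    obtain ⟨u, rfl⟩ := (conjC_mem_eigenL_iff (blockMap_blockMap hA)).1 hL.1
    have h := cliffordActC_mem_iSup_typeForms hA u (ih hL.2)
    rwa [sub_sub] at h

/-- The component of degree `p + q` of an element of `U^{p - q}` is of type `(p, q)`. -/
lemma component_mem_typeForms (hA : ∀ v, A (A v) = -v) (F : ComplexFrame A.toLinearMap n) {k : ℤ}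
    {φ : ExtForms V} (hφ : φ ∈ gradedU (blockMap A).toLinearMap n k) {d : ℕ} {p q : ℤ}
    (hd : p + q = d) (hk : p - q = k) : component d φ ∈ typeForms A.toLinearMap p q := by
  refine Submodule.iSup_induction (motive := fun φ => component d φ ∈ typeForms A.toLinearMap p q)
    _ (gradedU_le hA F k hφ) ?_ ?_ ?_
  · rintro ⟨⟨p', q'⟩, hpq⟩ ψ hψ
    dsimp only at hpq hψ
    have hdeg := typeForms_le_degreeForms p' q' hψ
    rcases eq_or_ne d (p' + q') with h | h
    · have h1 : (p' : ℤ) = p := by omega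
      have h2 : (q' : ℤ) = q := by omega
      rw [h, component_of_mem hdeg, ← h1, ← h2]
      exact hψ
    · rw [component_of_mem_of_ne hdeg h]
      exact Submodule.zero_mem _
  · rw [map_zero]; exact Submodule.zero_mem _
  · intro x y hx hy
    rw [map_add]
    exact Submodule.add_mem _ hx hy

/-- The case of `d` and `k` of opposite parity, where no type has total degree `d` and difference
`k`. -/
lemma component_eq_zero (hA : ∀ v, A (A v) = -v) (F : ComplexFrame A.toLinearMap n) {k : ℤ}
    {φ : ExtForms V} (hφ : φ ∈ gradedU (blockMap A).toLinearMap n k) {d : ℕ}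
    (h : ¬∃ p q : ℤ, p + q = d ∧ p - q = k) : component d φ = 0 := by
  refine Submodule.iSup_induction (motive := fun φ => component d φ = 0)
    _ (gradedU_le hA F k hφ) ?_ ?_ ?_
  · rintro ⟨⟨p', q'⟩, hpq⟩ ψ hψ
    refine component_of_mem_of_ne (typeForms_le_degreeForms p' q' hψ) fun hd => ?_
    exact h ⟨p', q', by simp [hd], hpq⟩
  · exact map_zero _
  · intro x y hx hy
    rw [map_add, hx, hy, add_zero]

end LinearAlgebra

/-! ### Independence and sums of a family grouped along a map -/

section Regrouping

variable {R N ι κ : Type*} [Ring R] [AddCommGroup N] [Module R N]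

/-- Independence can be checked in two steps: inside the fibres of a map, and for the sums over
the fibres. -/
lemma iSupIndep_iff_fibers (H : ι → Submodule R N) (f : ι → κ) :
    iSupIndep H ↔ (∀ k, iSupIndep fun a : {a // f a = k} => H a) ∧
      iSupIndep fun k => ⨆ a : {a // f a = k}, H a := by
  classical
  constructor
  · refine fun h => ⟨fun k => h.comp Subtype.val_injective, fun k => ?_⟩
    have hd : Disjoint {a | f a = k} {a | f a ≠ k} :=
      Set.disjoint_left.2 fun a ha ha' => ha' ha
    refine (h.disjoint_biSup_biSup hd).mono ?_ ?_
    · exact iSup_le fun a => le_iSup₂_of_le a.1 a.2 le_rfl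
    · refine iSup₂_le fun j hj => iSup_le fun a => le_iSup₂_of_le a.1 ?_ le_rfl
      exact fun h => hj (a.2.symm.trans h)
  · rintro ⟨h1, h2⟩
    rw [iSupIndep_iff_finsetSum_eq_zero_imp_eq_zero] at h2 ⊢
    intro s v hv h0 i hi
    -- Group the vanishing sum by fibres: every fibre sum is zero by independence of the fibre sums,
    -- and then every term by independence within its fibre.
    have hz := h2 (s.image f) (fun k => ∑ a ∈ s with f a = k, v a)
      (fun k _ => Submodule.sum_mem _ fun a ha => by
        rw [Finset.mem_filter] at ha
        exact Submodule.mem_iSup_of_mem (⟨a, ha.2⟩ : {a // f a = k}) (hv a ha.1))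
      (by rw [Finset.sum_fiberwise_of_maps_to fun a ha => Finset.mem_image_of_mem f ha, h0])
      (f i) (Finset.mem_image_of_mem f hi)
    have h3 := (iSupIndep_iff_finsetSum_eq_zero_imp_eq_zero _).1 (h1 (f i))
      (s.subtype fun a => f a = f i) (fun a => v a)
      (fun a ha => hv a (Finset.mem_subtype.1 ha))
      (by rw [Finset.sum_subtype_eq_sum_filter, hz])
    exact h3 ⟨i, rfl⟩ (Finset.mem_subtype.2 hi)

lemma iSup_fibers (H : ι → Submodule R N) (f : ι → κ) :
    ⨆ k, ⨆ a : {a // f a = k}, H a = ⨆ a, H a :=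
  le_antisymm (iSup_le fun _ => iSup_le fun a => le_iSup H a.1)
    (iSup_le fun a => le_iSup_of_le (f a)
      (le_iSup (fun b : {b // f b = f a} => H b) ⟨a, rfl⟩))

/-- Subspaces that are separated by a family of endomorphisms are independent. -/
lemma iSupIndep_of_projections {D : κ → Submodule R N} (π : κ → N →ₗ[R] N)
    (h1 : ∀ k, ∀ x ∈ D k, π k x = x) (h2 : ∀ k j, j ≠ k → ∀ x ∈ D j, π k x = 0) :
    iSupIndep D := by
  intro k
  rw [Submodule.disjoint_def]
  intro x hx hx'
  have hle : (⨆ (j) (_ : j ≠ k), D j) ≤ LinearMap.ker (π k) :=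
    iSup₂_le fun j hj y hy => h2 k j hj y hy
  rw [← h1 k x hx]
  exact hle hx'

end Regrouping

/-! ### The degree decomposition of de Rham cohomology -/

section Cohomology

variable {n : ℕ} {X : Type*} [TopologicalSpace X] [ChartedSpace (Model n) X]

/-- The part of degree `k` of a form (zero if `k < 0`). -/
def degreePart (k : ℤ) : RawForms n X →ₗ[ℂ] RawForms n X where
  toFun α j := if (j : ℤ) = k then α j else 0
  map_add' α β := by
    funext j
    change (if _ then α j + β j else 0) = (if _ then α j else 0) + (if _ then β j else 0)
    split_ifs
    · rfl
    · exact (add_zero (0 : (x : X) → TangentSpace (𝓡 (2 * n)) x [⋀^Fin j]→L[ℝ] ℂ)).symm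
  map_smul' c α := by
    funext j
    change (if _ then (c • α) j else 0) = (c • (fun j => if (j : ℤ) = k then α j else 0 :
      RawForms n X)) j
    change _ = fun x => c • (if (j : ℤ) = k then α j else 0) x
    split_ifs
    · rfl
    · funext x
      exact (smul_zero (A := TangentSpace (𝓡 (2 * n)) x [⋀^Fin j]→L[ℝ] ℂ) c).symm

lemma degreePart_same (j : ℕ) (α : RawForms n X) : degreePart (j : ℤ) α j = α j :=
  if_pos rfl

lemma degreePart_of_ne {j : ℕ} {k : ℤ} (h : (j : ℤ) ≠ k) (α : RawForms n X) :
    degreePart k α j = 0 := if_neg h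

lemma degreePart_mem (k : ℤ) (α : RawForms n X) : degreePart k α ∈ homogeneousForms n X k :=
  fun _ hj => degreePart_of_ne hj α

lemma degreePart_of_mem {k : ℤ} {α : RawForms n X} (h : α ∈ homogeneousForms n X k) :
    degreePart k α = α := by
  funext j
  rcases eq_or_ne (j : ℤ) k with rfl | hj
  · exact degreePart_same j α
  · rw [degreePart_of_ne hj, h j hj]

lemma degreePart_of_mem_of_ne {k l : ℤ} (hkl : l ≠ k) {α : RawForms n X}
    (h : α ∈ homogeneousForms n X l) : degreePart k α = 0 := by
  funext j
  rcases eq_or_ne (j : ℤ) k with rfl | hj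
  · rw [degreePart_same, h j hkl.symm]; rfl
  · rw [degreePart_of_ne hj]; rfl

lemma degreePart_at (d : ℕ) (α : RawForms n X) (x : X) :
    (degreePart (d : ℤ) α).at x = component d (α.at x) := by
  funext k
  rcases eq_or_ne k d with rfl | hk
  · rw [component_same]
    change (degreePart (k : ℤ) α k x).toAlternatingMap = _
    rw [degreePart_same]
    rfl
  · rw [component_of_ne hk]
    change (degreePart (d : ℤ) α k x).toAlternatingMap = _
    rw [degreePart_of_ne (by exact_mod_cast hk)]
    rfl

lemma IsSmooth.degreePart {α : RawForms n X} (h : IsSmooth α) (k : ℤ) :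
    IsSmooth (degreePart k α) := by
  intro j x₀
  rcases eq_or_ne (j : ℤ) k with rfl | hj
  · rw [degreePart_same]; exact h j x₀
  · rw [degreePart_of_ne hj]; exact (smoothForms n X).zero_mem j x₀

lemma extD_congr {α β : RawForms n X} {j : ℕ} (h : α j = β j) :
    extD α (j + 1) = extD β (j + 1) := by
  funext x
  simp only [extD, h]

/-- The exterior derivative is homogeneous of degree one. -/
lemma extD_degreePart (k : ℤ) (α : RawForms n X) :
    extD (degreePart k α) = degreePart (k + 1) (extD α) := by
  funext j
  have hzero : extD (0 : RawForms n X) = 0 := (closedForms n X).zero_mem.2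
  cases j with
  | zero =>
    rcases eq_or_ne ((0 : ℕ) : ℤ) (k + 1) with h | h
    · rw [← h, degreePart_same]; rfl
    · rw [degreePart_of_ne h]; rfl
  | succ j =>
    rcases eq_or_ne (j : ℤ) k with rfl | hj
    · have h : (j : ℤ) + 1 = ((j + 1 : ℕ) : ℤ) := by push_cast; rfl
      rw [h, degreePart_same]
      exact extD_congr (degreePart_same j α)
    · rw [degreePart_of_ne (by push_cast; omega),
        extD_congr (β := 0) (by rw [degreePart_of_ne hj]; rfl), hzero]
      rfl

lemma degreePart_mem_closedForms (k : ℤ) {α : RawForms n X} (h : α ∈ closedForms n X) :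
    degreePart k α ∈ closedForms n X :=
  ⟨h.1.degreePart k, by rw [extD_degreePart, h.2, map_zero]⟩

/-- The part of degree `k`, on closed forms. -/
def degreePartClosed (n : ℕ) (X : Type*) [TopologicalSpace X] [ChartedSpace (Model n) X] (k : ℤ) :
    closedForms n X →ₗ[ℂ] closedForms n X :=
  (degreePart k).restrict fun _ h => degreePart_mem_closedForms k h

/-- The projection of the de Rham cohomology to its part of degree `k`. -/
def degreeProj (n : ℕ) (X : Type*) [TopologicalSpace X] [ChartedSpace (Model n) X] (k : ℤ) :
    DeRham n X →ₗ[ℂ] DeRham n X :=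
  (exactForms n X).mapQ (exactForms n X) (degreePartClosed n X k) <| by
    rintro ⟨α, hα⟩ ⟨β, hβ, h⟩
    -- Since `d` raises degree by one, the part of `β` of degree `k - 1` is a primitive; for `k = 0`
    -- it is zero.
    refine ⟨degreePart (k - 1) β, hβ.degreePart _, ?_⟩
    rw [extD_degreePart, sub_add_cancel, h]
    rfl

lemma degreeProj_mk (k : ℤ) (α : closedForms n X) :
    degreeProj n X k ((exactForms n X).mkQ α) =
      (exactForms n X).mkQ (degreePartClosed n X k α) := rfl

lemma mem_classesOf {S : Submodule ℂ (RawForms n X)} {c : DeRham n X} :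
    c ∈ classesOf S ↔ ∃ α : closedForms n X, (α : RawForms n X) ∈ S ∧
      (exactForms n X).mkQ α = c := Iff.rfl

lemma classesOf_mono {S T : Submodule ℂ (RawForms n X)} (h : S ≤ T) : classesOf S ≤ classesOf T :=
  Submodule.map_mono (Submodule.comap_mono h)

variable (n X) in
-- The degree projections preserve closed and exact forms, so they act on cohomology and separate
-- the degrees there.
lemma iSupIndep_deRhamDeg : iSupIndep (deRhamDeg n X) := by
  refine iSupIndep_of_projections (degreeProj n X) ?_ ?_
  · rintro k _ ⟨α, hα, rfl⟩
    rw [degreeProj_mk]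
    exact congrArg _ (Subtype.ext (degreePart_of_mem hα))
  · rintro k j hj _ ⟨α, hα, rfl⟩
    rw [degreeProj_mk]
    have : degreePartClosed n X k α = 0 := Subtype.ext (degreePart_of_mem_of_ne hj hα)
    rw [this, map_zero]

lemma finrank_tangentSpace (x : X) :
    Module.finrank ℝ (TangentSpace (𝓡 (2 * n)) x) = 2 * n :=
  finrank_euclideanSpace_fin (𝕜 := ℝ) (n := 2 * n)

instance finiteDimensional_tangentSpace (x : X) :
    FiniteDimensional ℝ (TangentSpace (𝓡 (2 * n)) x) :=
  inferInstanceAs (FiniteDimensional ℝ (Model n))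

instance t2Space_tangentSpace (x : X) : T2Space (TangentSpace (𝓡 (2 * n)) x) :=
  inferInstanceAs (T2Space (Model n))

lemma RawForms.eq_zero_of_lt (α : RawForms n X) {j : ℕ} (h : 2 * n < j) : α j = 0 := by
  funext x
  refine ContinuousAlternatingMap.toAlternatingMap_injective ?_
  exact alternatingMap_eq_zero (by rwa [finrank_tangentSpace]) _

/-- A form is the sum of its parts of degree at most `2n`. -/
lemma sum_degreePart (α : RawForms n X) :
    ∑ d ∈ Finset.range (2 * n + 1), degreePart (d : ℤ) α = α := by
  funext j
  let ev : RawForms n X →+ ((x : X) → TangentSpace (𝓡 (2 * n)) x [⋀^Fin j]→L[ℝ] ℂ) :=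
    { toFun := fun β => β j, map_zero' := rfl, map_add' := fun _ _ => rfl }
  have hs : (∑ d ∈ Finset.range (2 * n + 1), degreePart (d : ℤ) α) j =
      ∑ d ∈ Finset.range (2 * n + 1), degreePart (d : ℤ) α j :=
    map_sum ev (fun d : ℕ => degreePart (d : ℤ) α) (Finset.range (2 * n + 1))
  rw [hs]
  by_cases hj : j < 2 * n + 1
  · rw [Finset.sum_eq_single_of_mem j (Finset.mem_range.2 hj)
      (fun d _ hd => degreePart_of_ne (by exact_mod_cast hd.symm) α), degreePart_same]
  · rw [RawForms.eq_zero_of_lt α (by omega)]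
    exact Finset.sum_eq_zero fun d _ => RawForms.eq_zero_of_lt _ (by omega)

lemma sum_degreePartClosed (α : closedForms n X) :
    ∑ d ∈ Finset.range (2 * n + 1), degreePartClosed n X (d : ℤ) α = α := by
  refine Subtype.ext ?_
  rw [AddSubmonoidClass.coe_finsetSum]
  exact sum_degreePart (α : RawForms n X)

variable (n X) in
-- The degree parts of a closed form are closed, and only those of degree at most `2n` can be
-- nonzero.
lemma iSup_deRhamDeg : ⨆ k, deRhamDeg n X k = ⊤ := by
  rw [eq_top_iff]
  intro c _
  obtain ⟨α, rfl⟩ := (exactForms n X).mkQ_surjective c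
  rw [← sum_degreePartClosed α, map_sum]
  exact Submodule.sum_mem _ fun d _ => Submodule.mem_iSup_of_mem (d : ℤ)
    ⟨_, degreePart_mem (d : ℤ) (α : RawForms n X), rfl⟩

end Cohomology

/-! ### Comparison of `GH^{(k)}` with the spaces `H^{(p,q)}` -/

section Comparison

variable {n : ℕ} {X : Type*} [TopologicalSpace X] [ChartedSpace (Model n) X]

lemma RawForms.eq_zero_of_at {α : RawForms n X} {j : ℕ} (h : ∀ x, α.at x j = 0) : α j = 0 :=
  funext fun x => ContinuousAlternatingMap.toAlternatingMap_injective (h x)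

variable [IsManifold (𝓡 (2 * n)) ∞ X] (J : AlmostComplex n X)

lemma AlmostComplex.exists_frame (x : X) :
    Nonempty (ComplexFrame (J.toFun x).toLinearMap n) :=
  exists_complexFrame (J.sq x) (finrank_tangentSpace x)

lemma AlmostComplex.H_le_deRhamDeg (p q : ℤ) : J.H p q ≤ deRhamDeg n X (p + q) := by
  refine classesOf_mono fun α hα j hj => RawForms.eq_zero_of_at fun x => ?_
  have hx : α.at x ∈ typeForms (J.toFun x).toLinearMap p q := hα x
  by_cases h : p < 0 ∨ q < 0
  · rw [typeForms_eq_bot h, Submodule.mem_bot] at hx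
    rw [hx]
    rfl
  push Not at h
  obtain ⟨h1, h2⟩ := h
  lift p to ℕ using h1
  lift q to ℕ using h2
  exact typeForms_le_degreeForms p q hx j (by exact_mod_cast hj)

lemma AlmostComplex.H_le_GH (p q : ℤ) : J.H p q ≤ J.toGen.GH (p - q) := by
  refine classesOf_mono fun α hα x => ?_
  obtain ⟨F⟩ := J.exists_frame x
  exact typeForms_le_gradedU (J.sq x) F p q (hα x)

/-- The degree part of a closed form is closed, and in `U^k` it is of the one type with `p + q = d`
and `p - q = k`, or zero if there is none. So it represents a class in a single `H^{(p,q)}`. -/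
lemma AlmostComplex.mk_degreePart_mem {k : ℤ} {α : closedForms n X}
    (hα : (α : RawForms n X) ∈ J.toGen.formsU k) (d : ℕ) :
    (exactForms n X).mkQ (degreePartClosed n X (d : ℤ) α) ∈
      ⨆ a : {a : ℤ × ℤ // a.1 - a.2 = k}, J.H a.1.1 a.1.2 := by
  by_cases h : ∃ p q : ℤ, p + q = d ∧ p - q = k
  · obtain ⟨p, q, hd, hk⟩ := h
    refine Submodule.mem_iSup_of_mem (⟨(p, q), hk⟩ : {a : ℤ × ℤ // a.1 - a.2 = k})
      (mem_classesOf.2 ⟨_, fun x => ?_, rfl⟩)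
    obtain ⟨F⟩ := J.exists_frame x
    change (degreePart (d : ℤ) (α : RawForms n X)).at x ∈ _
    rw [degreePart_at]
    exact component_mem_typeForms (J.sq x) F (hα x) hd hk
  · have h0 : degreePartClosed n X (d : ℤ) α = 0 := by
      refine Subtype.ext (funext fun j => RawForms.eq_zero_of_at fun x => ?_)
      obtain ⟨F⟩ := J.exists_frame x
      change (degreePart (d : ℤ) (α : RawForms n X)).at x j = 0
      rw [degreePart_at, component_eq_zero (J.sq x) F (hα x) h]
      rfl
    rw [h0, map_zero]
    exact Submodule.zero_mem _

lemma AlmostComplex.GH_toGen (k : ℤ) :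
    J.toGen.GH k = ⨆ a : {a : ℤ × ℤ // a.1 - a.2 = k}, J.H a.1.1 a.1.2 := by
  apply le_antisymm
  · intro c hc
    obtain ⟨α, hα, rfl⟩ := mem_classesOf.1 hc
    rw [← sum_degreePartClosed α, map_sum]
    exact Submodule.sum_mem _ fun d _ => J.mk_degreePart_mem hα d
  · refine iSup_le ?_
    rintro ⟨⟨p, q⟩, rfl⟩
    exact J.H_le_GH p q

/-- For fixed `p - q` the pair is determined by `p + q`, so distinct terms lie in de Rham groups of
distinct degrees. -/
lemma AlmostComplex.iSupIndep_H_sub (k : ℤ) :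
    iSupIndep fun a : {a : ℤ × ℤ // a.1 - a.2 = k} => J.H a.1.1 a.1.2 := by
  have hinj : Function.Injective fun a : {a : ℤ × ℤ // a.1 - a.2 = k} => a.1.1 + a.1.2 := by
    rintro ⟨⟨p, q⟩, h⟩ ⟨⟨p', q'⟩, h'⟩ heq
    simp only [Subtype.mk.injEq, Prod.mk.injEq] at h h' heq ⊢
    omega
  exact ((iSupIndep_deRhamDeg n X).comp hinj).mono fun a => J.H_le_deRhamDeg a.1.1 a.1.2

lemma AlmostComplex.iSup_H_add_le (k : ℤ) :
    ⨆ a : {a : ℤ × ℤ // a.1 + a.2 = k}, J.H a.1.1 a.1.2 ≤ deRhamDeg n X k := by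
  refine iSup_le ?_
  rintro ⟨⟨p, q⟩, rfl⟩
  exact J.H_le_deRhamDeg p q

lemma AlmostComplex.isPure_toGen_iff :
    J.toGen.IsPure ↔ iSupIndep fun a : ℤ × ℤ => J.H a.1 a.2 := by
  rw [iSupIndep_iff_fibers _ fun a : ℤ × ℤ => a.1 - a.2, GenAlmostComplex.IsPure,
    funext J.GH_toGen]
  exact (and_iff_right J.iSupIndep_H_sub).symm

lemma AlmostComplex.isFull_toGen_iff :
    J.toGen.IsFull ↔ ⨆ a : ℤ × ℤ, J.H a.1 a.2 = ⊤ := by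
  rw [← iSup_fibers _ fun a : ℤ × ℤ => a.1 - a.2, GenAlmostComplex.IsFull, funext J.GH_toGen]

/-- Grouping by `p + q`, the fibre sums lie in the independent spaces `H^k_dR` and so are
independent for free; only independence inside fibres and the total sum carry content. -/
lemma AlmostComplex.forall_isPureAndFullAt_iff :
    (∀ k, J.IsPureAndFullAt k) ↔
      (iSupIndep fun a : ℤ × ℤ => J.H a.1 a.2) ∧ ⨆ a : ℤ × ℤ, J.H a.1 a.2 = ⊤ := by
  have hle : (fun k => ⨆ a : {a : ℤ × ℤ // a.1 + a.2 = k}, J.H a.1.1 a.1.2) ≤ deRhamDeg n X :=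
    J.iSup_H_add_le
  rw [iSupIndep_iff_fibers _ fun a : ℤ × ℤ => a.1 + a.2,
    ← iSup_fibers _ fun a : ℤ × ℤ => a.1 + a.2,
    and_iff_left ((iSupIndep_deRhamDeg n X).mono hle)]
  refine forall_and.trans (and_congr Iff.rfl ⟨fun h => ?_, fun h => ?_⟩)
  · exact (iSup_congr h).trans (iSup_deRhamDeg n X)
  · exact congrFun (((iSupIndep_deRhamDeg n X).le_iff_eq_of_iSup_eq_top h).1 hle)

end Comparison

end GenComplex

end

theorem proposition2p8 (n : ℕ) (X : Type*) [TopologicalSpace X]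
    [ChartedSpace (GenComplex.Model n) X] [IsManifold (𝓡 (2 * n)) ∞ X]
    [CompactSpace X] [T2Space X] (J : GenComplex.AlmostComplex n X) :
    (∀ k : ℤ,
      iSupIndep (fun a : {a : ℤ × ℤ // a.1 - a.2 = k} => J.H a.1.1 a.1.2) ∧
      J.toGen.GH k = ⨆ a : {a : ℤ × ℤ // a.1 - a.2 = k}, J.H a.1.1 a.1.2) ∧
    (J.toGen.IsPureAndFull ↔ ∀ k : ℤ, J.IsPureAndFullAt k) :=
  ⟨fun k => ⟨J.iSupIndep_H_sub k, J.GH_toGen k⟩,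
    (and_congr J.isPure_toGen_iff J.isFull_toGen_iff).trans J.forall_isPureAndFullAt_iff.symm⟩
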